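/- Conventions. A diffeological space carries its D-topology (a set is open iff its preimage under every plot is open); subsets and products carry the subspace and product diffeologies, and $[0,1]\subset\mathbb{R}$ is a diffeological subspace. A diffeological groupoid $\Gamma$ is a small groupoid whose set of arrows $\Gamma^{(1)}$ is a diffeological space such that source $s$, range $r$, composition and inversion are smooth, where the set of objects $\Gamma^{(0)}$ has the subspace diffeology given by the unit map; $gk$ is defined when $s(g)=r(k)$. $\Gamma$-structures. A $\Gamma$-cocycle on a diffeological space $X$ over an open cover $(U_\alpha)_{\alpha\in A}$ is a smooth morphism from the Čech groupoid of the cover to $\Gamma$, i.e. a family of smooth maps $h_{\alpha\beta}:U_\alpha\cap U_\beta\to\Gamma^{(1)}$ such that on $U_\alpha\cap U_\beta\cap U_\delta$ the arrows $h_{\alpha\beta}(x)$, $h_{\beta\delta}(x)$ are composable with $h_{\alpha\beta}(x)h_{\beta\delta}(x)=h_{\alpha\delta}(x)$. Two cocycles over covers $\mathcal{U}$, $\mathcal{V}$ are equivalent if they are the restrictions of a cocycle over the cover $\mathcal{U}\cup\mathcal{V}$ (indexed by the disjoint union). A $\Gamma$-structure is an equivalence class of $\Gamma$-cocycles; $\Gamma$-structures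 pull back along smooth maps. A countable open cover $(U_\alpha)$ is smoothly numerable if there are smooth functions $\lambda_\alpha:X\to[0,1]$ with $\sum_\alpha\lambda_\alpha=1$ such that the closures $\overline{\{\lambda_\alpha>0\}}$ form a locally finite family and $\overline{\{\lambda_\alpha>0\}}\subset U_\alpha$ for all $\alpha$. A $\Gamma$-structure is smoothly numerable if it is represented by a cocycle over a countable, smoothly numerable open cover. Two $\Gamma$-structures on $X$ are smoothly, numerably homotopic if there is a smoothly numerable $\Gamma$-structure on $X\times[0,1]$ whose pullbacks along $x\mapsto(x,0)$ and $x\mapsto(x,1)$ are the given ones. Smooth maps $\eta_0,\eta_1:X\to Y$ are smoothly homotopic if there is a smooth map $H:X\times[0,1]\to Y$ with $H(\cdot,0)=\eta_0$ and $H(\cdot,1)=\eta_1$. The classifying space. Let $\mathbb{N}^{(n)}$ be the set of tuples $\alpha_0<\dots<\alpha_n$ of natural numbers, with face maps $\partial_i$ omitting the $i$-th entry, and let $\Gamma^{(n)}$ be the nerve of $\Gamma$: the composable $n$-tuples $(\gamma_1,\dots,\gamma_n)$ (the objects, if $n=0$), where $\partial_0$ drops $\gamma_1$, $\partial_i$ replaces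 $\gamma_i,\gamma_{i+1}$ by $\gamma_i\gamma_{i+1}$, and the last face map drops the last arrow (on $\Gamma^{(1)}$, $\partial_0=s$ and $\partial_1=r$). As a set, $B\Gamma$ is the fat realisation $\big(\bigsqcup_n\Delta_n\times\mathbb{N}^{(n)}\times\Gamma^{(n)}\big)/\!\sim$, where $\sim$ is generated by $(d_i(t),y)\sim(t,\partial_i(y))$ and $d_i:\Delta_n\to\Delta_{n+1}$ inserts a $0$ at position $i$. The function $u_\alpha:B\Gamma\to[0,1]$ takes the class of $(t_0,\dots,t_n;\alpha_0,\dots,\alpha_n;\gamma_1,\dots,\gamma_n)$ to $t_j$ if $\alpha=\alpha_j$ and to $0$ if there is no such $j$; put $U_\alpha=\{u_\alpha>0\}$. On $U_\alpha\cap U_\beta$ let $\gamma_{\alpha\beta}$ be $g_i^{-1}g_j$, where $\alpha=\alpha_i$, $\beta=\alpha_j$, $g_i=\gamma_1\cdots\gamma_i$, and $g_0$ is the unit at $r(\gamma_1)$ (at the given object, if $n=0$). The Mostow diffeology on $B\Gamma$ is the largest diffeology for which all $u_\alpha$ are smooth and all $\gamma_{\alpha\beta}$ are locally smooth: a map $P$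 is a plot iff all $u_\alpha\circ P$ are smooth, all sets $P^{-1}(U_\alpha\cap U_\beta)$ are open, and all $\gamma_{\alpha\beta}\circ P$ are plots of $\Gamma^{(1)}$ on these sets. The $\gamma_{\alpha\beta}$ form a $\Gamma$-cocycle over $(U_\alpha)_{\alpha\in\mathbb{N}}$, whose class $\gamma$ is the canonical $\Gamma$-structure on $B\Gamma$. Theorem. Let $\Gamma$ be a diffeological groupoid. (1) The canonical $\Gamma$-structure $\gamma$ on $B\Gamma$, with the Mostow diffeology, is smoothly numerable. (2) For every diffeological space $X$ and every smoothly numerable $\Gamma$-structure $h$ on $X$ there is a smooth map $\eta:X\to B\Gamma$ with $h=\eta^*\gamma$. (3) If $X$ is a diffeological space and $\eta_0,\eta_1:X\to B\Gamma$ are smooth maps, then the $\Gamma$-structures $\eta_0^*\gamma$ and $\eta_1^*\gamma$ are smoothly, numerably homotopic if and only if $\eta_0$ and $\eta_1$ are smoothly homotopic. -/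

import Mathlib

open CategoryTheory Diffeology
open scoped ContDiff Topology

universe u v w x

/-! ### Subspace and product diffeologies

Mathlib's `DiffeologicalSpace` records the plots whose domain is a full Euclidean space; since every
open subset of a Euclidean space is covered by open balls, each of them diffeomorphic to the whole
space, this is the same datum as a diffeology given by plots on arbitrary open subsets. -/

/-- The pullback of a diffeology along a map `f`: a map `p` is a plot iff `f ∘ p` is one. -/
@[reducible] def DiffeologicalSpace.induced {X : Type*} {Y : Type*} (f : X → Y)
    (d : DiffeologicalSpace Y) : DiffeologicalSpace X where
  plots n := {p | IsPlot (f ∘ p)}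
  constant_plots x := isPlot_const (x := f x)
  plot_reparam hp hf := isPlot_reparam (X := Y) hp hf
  locality {n p} hp := d.locality (p := f ∘ p) fun y ↦ by
    obtain ⟨s, hs, hy, h⟩ := hp y
    exact ⟨s, hs, hy, fun hf hf' ↦ h hf hf'⟩

/-- The subspace diffeology. -/
instance Subtype.instDiffeologicalSpace {X : Type*} [d : DiffeologicalSpace X] {q : X → Prop} :
    DiffeologicalSpace (Subtype q) :=
  DiffeologicalSpace.induced Subtype.val d

/-- The product diffeology. -/
instance Prod.instDiffeologicalSpace {X : Type*} {Y : Type*} [d : DiffeologicalSpace X]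
    [e : DiffeologicalSpace Y] : DiffeologicalSpace (X × Y) where
  plots n := {p | IsPlot (fun a ↦ (p a).1) ∧ IsPlot (fun a ↦ (p a).2)}
  constant_plots _ := ⟨isPlot_const, isPlot_const⟩
  plot_reparam hp hf := ⟨isPlot_reparam hp.1 hf, isPlot_reparam hp.2 hf⟩
  locality {n p} hp := by
    refine ⟨d.locality fun y ↦ ?_, e.locality fun y ↦ ?_⟩
    · obtain ⟨s, hs, hy, h⟩ := hp y
      exact ⟨s, hs, hy, fun hf hf' ↦ (h hf hf').1⟩
    · obtain ⟨s, hs, hy, h⟩ := hp y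
      exact ⟨s, hs, hy, fun hf hf' ↦ (h hf hf').2⟩

theorem isPlot_subtype_iff {X : Type*} [DiffeologicalSpace X] {q : X → Prop} {n : ℕ}
    {p : EuclideanSpace ℝ (Fin n) → Subtype q} : IsPlot p ↔ IsPlot fun y ↦ (p y : X) :=
  Iff.rfl

/-- A map `f` defined on a subset `U` of `X` is *locally smooth* if, for each plot `p` of `X`, the
set `p ⁻¹' U` is open and `f ∘ p : p ⁻¹' U → Y` is a plot (i.e. is smooth on this open set). -/
def LocallySmooth {X : Type*} {Y : Type*} [DiffeologicalSpace X] [DiffeologicalSpace Y]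
    (U : Set X) (f : U → Y) : Prop :=
  ∀ (n : ℕ) (p : EuclideanSpace ℝ (Fin n) → X), IsPlot p →
    IsOpen (p ⁻¹' U) ∧ DSmooth (fun y : ↥(p ⁻¹' U) ↦ f ⟨p y, y.2⟩)

/-! ### Diffeological groupoids -/

/-- The set `Γ⁽¹⁾` of all arrows of a groupoid `Γ`. -/
@[ext] structure Arr (Γ : Type u) [Groupoid.{v} Γ] where
  /-- source -/
  src : Γ
  /-- range (target) -/
  tgt : Γ
  /-- the arrow from the source to the range -/
  hom : src ⟶ tgt

namespace Arr

variable {Γ : Type u} [Groupoid.{v} Γ]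

/-- The unit arrow at an object. -/
def unit (a : Γ) : Arr Γ := ⟨a, a, 𝟙 a⟩

/-- The inverse arrow. -/
def inv (g : Arr Γ) : Arr Γ := ⟨g.tgt, g.src, Groupoid.inv g.hom⟩

/-- The composite `g k` (first `k`, then `g`), defined when the source of `g` is the range
of `k`. -/
def comp (g k : Arr Γ) (h : g.src = k.tgt) : Arr Γ :=
  ⟨k.src, g.tgt, k.hom ≫ eqToHom h.symm ≫ g.hom⟩

/-- `g` and `k` are composable, and `g k = l`. -/
def IsComp (g k l : Arr Γ) : Prop := ∃ h : g.src = k.tgt, g.comp k h = l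

theorem IsComp.eq {g k l l' : Arr Γ} (h : g.IsComp k l) (h' : g.IsComp k l') : l = l' := by
  obtain ⟨_, rfl⟩ := h
  obtain ⟨_, rfl⟩ := h'
  rfl

theorem IsComp.src_eq {g k l : Arr Γ} (h : g.IsComp k l) : l.src = k.src := by
  obtain ⟨_, rfl⟩ := h; rfl

/-- `g k⁻¹` for arrows with the same source. -/
def div (g k : Arr Γ) (h : g.src = k.src) : Arr Γ := g.comp k.inv h

theorem div_comp {g k l : Arr Γ} (h : g.src = k.src) (h' : k.src = l.src) :
    (g.div k h).IsComp (k.div l h') (g.div l (h.trans h')) := by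
  obtain ⟨a, b, g⟩ := g
  obtain ⟨a', c, k⟩ := k
  obtain ⟨a'', d, l⟩ := l
  obtain rfl : a = a' := h
  obtain rfl : a = a'' := h'
  exact ⟨rfl, by simp [div, comp, inv]⟩

theorem div_eq_div {g k z g' k' : Arr Γ} (h : g.src = k.src) (h' : g'.src = k'.src)
    (hg : g.IsComp z g') (hk : k.IsComp z k') : g.div k h = g'.div k' h' := by
  obtain ⟨a, b, g⟩ := g
  obtain ⟨a', c, k⟩ := k
  obtain ⟨d, e, z⟩ := z
  obtain rfl : a = a' := h
  obtain ⟨e1, rfl⟩ := hg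
  obtain ⟨e2, rfl⟩ := hk
  obtain rfl : a = e := e1
  simp [div, comp, inv]

theorem div_eq_of_isComp {g k l : Arr Γ} (h : k.src = l.src) (hg : g.IsComp l k) :
    k.div l h = g := by
  obtain ⟨a, b, g⟩ := g
  obtain ⟨d, e, l⟩ := l
  obtain ⟨e1, rfl⟩ := hg
  obtain rfl : a = e := e1
  simp [div, comp, inv]

end Arr

/-- A groupoid is *diffeological* if its set of arrows is a diffeological space for which the
range, source, composition and inversion maps are smooth; here the set of objects carries the
subspace diffeology given by the unit map, and the set of composable pairs the subspace diffeology
of the product. -/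
class DiffeologicalGroupoid (Γ : Type u) [Groupoid.{v} Γ] [DiffeologicalSpace (Arr Γ)] : Prop where
  smooth_src : @DSmooth (Arr Γ) Γ _ (.induced Arr.unit inferInstance) Arr.src
  smooth_tgt : @DSmooth (Arr Γ) Γ _ (.induced Arr.unit inferInstance) Arr.tgt
  smooth_inv : DSmooth (Arr.inv : Arr Γ → Arr Γ)
  smooth_comp : DSmooth fun p : {p : Arr Γ × Arr Γ // p.1.src = p.2.tgt} ↦ p.1.1.comp p.1.2 p.2

/-! ### Cocycles and `Γ`-structures -/

section Cocycle

variable {Γ : Type u} [Groupoid.{v} Γ] [DiffeologicalSpace (Arr Γ)]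
  {X : Type x} [DiffeologicalSpace X] {Y : Type*} [DiffeologicalSpace Y]

/-- The family `h α β : U α ∩ U β → Γ⁽¹⁾` is a smooth morphism of groupoids from the Čech groupoid
of `U` to `Γ`. The arrows of the Čech groupoid are the triples `(y, α, β)` with `y ∈ U α ∩ U β`,
composed by `(y, α, β) (y, β, δ) = (y, α, δ)`, and a map on the disjoint union of the
`U α ∩ U β` is smooth iff each of its components is. -/
structure IsCocycle {ι : Type*} (U : ι → Set X) (h : ∀ α β, ↥(U α ∩ U β) → Arr Γ) : Prop where
  smooth : ∀ α β, DSmooth (h α β)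
  comp : ∀ α β δ y (hα : y ∈ U α) (hβ : y ∈ U β) (hδ : y ∈ U δ),
    (h α β ⟨y, hα, hβ⟩).IsComp (h β δ ⟨y, hβ, hδ⟩) (h α δ ⟨y, hα, hδ⟩)

variable (Γ X) in
/-- A `Γ`-cocycle on `X` over some D-open cover, indexed by a type in the universe `w`. -/
structure GammaCocycle where
  /-- the index set of the cover -/
  ι : Type w
  /-- the cover -/
  U : ι → Set X
  isOpen_U : ∀ α, IsOpen[dTopology] (U α)
  cover : ⋃ α, U α = Set.univ
  /-- the components of the morphism from the Čech groupoid -/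
  h : ∀ α β, ↥(U α ∩ U β) → Arr Γ
  isCocycle : IsCocycle U h

/-- Two cocycles over covers `U` and `V` are *equivalent* if they are the restrictions of a
cocycle over the cover `U ∪ V` (indexed by the disjoint union of the index sets). -/
def GammaCocycle.Equivalent (c d : GammaCocycle.{u, v, w} Γ X) : Prop :=
  ∃ h : ∀ α β : c.ι ⊕ d.ι, ↥(Sum.elim c.U d.U α ∩ Sum.elim c.U d.U β) → Arr Γ,
    IsCocycle (Sum.elim c.U d.U) h ∧
    (∀ α β y, h (.inl α) (.inl β) y = c.h α β y) ∧
    (∀ α β y, h (.inr α) (.inr β) y = d.h α β y)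

/-- Reindexing and pulling back a cocycle. -/
theorem IsCocycle.reindex {ι κ : Type*} {U : ι → Set X} {h : ∀ α β, ↥(U α ∩ U β) → Arr Γ}
    (hh : IsCocycle U h) {V : κ → Set Y} {φ : Y → X} (hφ : DSmooth φ) (f : κ → ι)
    (hf : ∀ k, ∀ y ∈ V k, φ y ∈ U (f k)) :
    IsCocycle V fun k l (y : ↥(V k ∩ V l)) ↦
      h (f k) (f l) ⟨φ y, hf k y y.2.1, hf l y y.2.2⟩ where
  smooth k l n p hp :=
    hh.smooth (f k) (f l) n (fun a ↦ ⟨φ (p a), hf k _ (p a).2.1, hf l _ (p a).2.2⟩)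
      (hφ n (fun a ↦ (p a : Y)) hp)
  comp k l m y hk hl hm := hh.comp _ _ _ _ (hf k y hk) (hf l y hl) (hf m y hm)

theorem GammaCocycle.Equivalent.refl (c : GammaCocycle.{u, v, w} Γ X) : c.Equivalent c :=
  ⟨_, c.isCocycle.reindex dSmooth_id (Sum.elim id id) (by rintro (k | k) y hy <;> exact hy),
    fun _ _ _ ↦ rfl, fun _ _ _ ↦ rfl⟩

theorem GammaCocycle.Equivalent.symm {c d : GammaCocycle.{u, v, w} Γ X} (h : c.Equivalent d) :
    d.Equivalent c := by
  obtain ⟨h, h1, h2, h3⟩ := h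
  exact ⟨_, h1.reindex dSmooth_id Sum.swap (by rintro (k | k) y hy <;> exact hy),
    fun α β y ↦ h3 α β y, fun α β y ↦ h2 α β y⟩

/-- Gluing a cocycle out of arrows to the members of a second cocycle. -/
theorem IsCocycle.glue [DiffeologicalGroupoid Γ] (d : GammaCocycle.{u, v, w} Γ X) {κ : Type*}
    (W : κ → Set X) (m : ∀ (j : κ) (i : d.ι), ↥(W j ∩ d.U i) → Arr Γ)
    (hm : ∀ j i, DSmooth (m j i))
    (hmd : ∀ j i i' y (hj : y ∈ W j) (hi : y ∈ d.U i) (hi' : y ∈ d.U i'),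
      (m j i ⟨y, hj, hi⟩).IsComp (d.h i i' ⟨y, hi, hi'⟩) (m j i' ⟨y, hj, hi'⟩)) :
    ∃ h : ∀ j k, ↥(W j ∩ W k) → Arr Γ, IsCocycle W h ∧
      ∀ j k i y (hj : y ∈ W j) (hk : y ∈ W k) (hi : y ∈ d.U i),
        ∃ e, h j k ⟨y, hj, hk⟩ = (m j i ⟨y, hj, hi⟩).div (m k i ⟨y, hk, hi⟩) e := by
  have hsrc : ∀ j k i y (hj : y ∈ W j) (hk : y ∈ W k) (hi : y ∈ d.U i),
      (m j i ⟨y, hj, hi⟩).src = (m k i ⟨y, hk, hi⟩).src := fun j k i y hj hk hi ↦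
    (hmd j i i y hj hi hi).src_eq.trans (hmd k i i y hk hi hi).src_eq.symm
  have hcov : ∀ y, ∃ i, y ∈ d.U i := fun y ↦ by
    have := d.cover.symm ▸ Set.mem_univ y
    simpa using this
  choose v hv using hcov
  have key : ∀ j k i y (hj : y ∈ W j) (hk : y ∈ W k) (hi : y ∈ d.U i),
      (m j (v y) ⟨y, hj, hv y⟩).div (m k (v y) ⟨y, hk, hv y⟩) (hsrc j k _ y hj hk (hv y)) =
      (m j i ⟨y, hj, hi⟩).div (m k i ⟨y, hk, hi⟩) (hsrc j k i y hj hk hi) :=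
    fun j k i y hj hk hi ↦
      Arr.div_eq_div (hsrc j k _ y hj hk (hv y)) (hsrc j k i y hj hk hi) (hmd j (v y) i y hj (hv y) hi)
        (hmd k (v y) i y hk (hv y) hi)
  refine ⟨fun j k y ↦ (m j (v y) ⟨y, y.2.1, hv y⟩).div (m k (v y) ⟨y, y.2.2, hv y⟩)
    (hsrc j k _ y y.2.1 y.2.2 (hv y)), ⟨?_, ?_⟩, ?_⟩
  · intro j k n p hp
    refine DiffeologicalSpace.locality fun a ↦ ?_
    refine ⟨(fun b ↦ (p b : X)) ⁻¹' d.U (v (p a)), ?_, hv (p a), ?_⟩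
    · exact isOpen_iff_preimages_plots.1 (d.isOpen_U _) n _ hp
    · intro r f hf hfs
      have hq : IsPlot fun b ↦ (p (f b) : X) := isPlot_reparam (X := X) hp hfs
      have e1 : IsPlot fun b ↦ m j (v (p a)) ⟨p (f b), (p (f b)).2.1, hf b⟩ :=
        hm j (v (p a)) r (fun b ↦ ⟨p (f b), (p (f b)).2.1, hf b⟩) hq
      have e2 : IsPlot fun b ↦ m k (v (p a)) ⟨p (f b), (p (f b)).2.2, hf b⟩ :=
        hm k (v (p a)) r (fun b ↦ ⟨p (f b), (p (f b)).2.2, hf b⟩) hq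
      have e3 := DiffeologicalGroupoid.smooth_inv r _ e2
      have e4 := DiffeologicalGroupoid.smooth_comp (Γ := Γ) r
        (fun b ↦ ⟨(m j (v (p a)) ⟨p (f b), (p (f b)).2.1, hf b⟩,
          (m k (v (p a)) ⟨p (f b), (p (f b)).2.2, hf b⟩).inv), hsrc j k _ (p (f b)) (p (f b)).2.1 (p (f b)).2.2 (hf b)⟩) ⟨e1, e3⟩
      convert! e4 using 1
      funext b
      exact key j k _ _ (p (f b)).2.1 (p (f b)).2.2 (hf b)
  · intro j k l y hj hk hl
    exact Arr.div_comp _ _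
  · intro j k i y hj hk hi
    exact ⟨hsrc j k i y hj hk hi, key j k i y hj hk hi⟩

theorem GammaCocycle.Equivalent.trans [DiffeologicalGroupoid Γ] {c d f : GammaCocycle.{u, v, w} Γ X}
    (h : c.Equivalent d) (h' : d.Equivalent f) : c.Equivalent f := by
  obtain ⟨p, p1, p2, p3⟩ := h
  obtain ⟨q, q1, q2, q3⟩ := h'
  obtain ⟨h, h1, h2⟩ := IsCocycle.glue d (Sum.elim c.U f.U)
    (fun j i ↦ match j with
      | .inl α => p (.inl α) (.inr i)
      | .inr α => q (.inr α) (.inl i))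
    (by rintro (α | α) i; exacts [p1.smooth _ _, q1.smooth _ _])
    (by
      rintro (α | α) i i' y hj hi hi'
      · have := p1.comp (.inl α) (.inr i) (.inr i') y hj hi hi'
        rwa [p3] at this
      · have := q1.comp (.inr α) (.inl i) (.inl i') y hj hi hi'
        rwa [q2] at this)
  have hcov : ∀ y, ∃ i, y ∈ d.U i := fun y ↦ by
    have := d.cover.symm ▸ Set.mem_univ y
    simpa using this
  refine ⟨h, h1, ?_, ?_⟩
  · rintro α β ⟨y, hα, hβ⟩
    obtain ⟨i, hi⟩ := hcov y
    obtain ⟨e, he⟩ := h2 (.inl α) (.inl β) i y hα hβ hi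
    rw [he]
    have := p1.comp (.inl α) (.inl β) (.inr i) y hα hβ hi
    rw [p2] at this
    exact Arr.div_eq_of_isComp _ this
  · rintro α β ⟨y, hα, hβ⟩
    obtain ⟨i, hi⟩ := hcov y
    obtain ⟨e, he⟩ := h2 (.inr α) (.inr β) i y hα hβ hi
    rw [he]
    have := q1.comp (.inr α) (.inr β) (.inl i) y hα hβ hi
    rw [q3] at this
    exact Arr.div_eq_of_isComp _ this

variable (Γ X) in
/-- Equivalence of cocycles. -/
@[reducible] def GammaCocycle.setoid [DiffeologicalGroupoid Γ] :
    Setoid (GammaCocycle.{u, v, w} Γ X) where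
  r := GammaCocycle.Equivalent
  iseqv := ⟨.refl, .symm, .trans⟩

variable (Γ X) in
/-- A `Γ`-structure on `X`: an equivalence class of `Γ`-cocycles. -/
def GammaStructure [DiffeologicalGroupoid Γ] :=
  Quotient (GammaCocycle.setoid.{u, v, w} Γ X)

/-- The pullback of a cocycle along a smooth map. -/
def GammaCocycle.pullback (c : GammaCocycle.{u, v, w} Γ X) (φ : Y → X) (hφ : DSmooth φ) :
    GammaCocycle.{u, v, w} Γ Y where
  ι := c.ι
  U α := φ ⁻¹' c.U α
  isOpen_U α := continuous_def.1 hφ.continuous _ (c.isOpen_U α)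
  cover := by rw [← Set.preimage_iUnion, c.cover, Set.preimage_univ]
  h α β y := c.h α β ⟨φ y, y.2⟩
  isCocycle := c.isCocycle.reindex hφ id fun _ _ hy ↦ hy

/-- The pullback of a `Γ`-structure along a smooth map. -/
def GammaStructure.pullback [DiffeologicalGroupoid Γ] (s : GammaStructure.{u, v, w} Γ X)
    (φ : Y → X) (hφ : DSmooth φ) : GammaStructure.{u, v, w} Γ Y :=
  Quotient.map (fun c ↦ c.pullback φ hφ) (by
    rintro c d ⟨h, h1, h2, h3⟩
    exact ⟨_, h1.reindex hφ id (by rintro (k | k) y hy <;> exact hy),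
      fun α β y ↦ h2 α β ⟨φ y, y.2⟩, fun α β y ↦ h3 α β ⟨φ y, y.2⟩⟩) s

/-! ### Numerability and homotopy -/

/-- A countable cover `U` is *smoothly numerable* if it admits a smooth partition of unity `lam`
that is locally finite (the D-closures of the sets `{lam α > 0}` form a locally finite family for
the D-topology) and subordinate (the D-closure of `{lam α > 0}` lies in `U α`). -/
def SmoothlyNumerableCover {ι : Type*} (U : ι → Set X) : Prop :=
  Countable ι ∧ ∃ lam : ι → X → ℝ,
    (∀ α, DSmooth (lam α)) ∧ (∀ α y, lam α y ∈ Set.Icc (0 : ℝ) 1) ∧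
    @LocallyFinite ι X dTopology (fun α ↦ @closure X dTopology {y | 0 < lam α y}) ∧
    (∀ y, ∑ᶠ α, lam α y = 1) ∧
    ∀ α, @closure X dTopology {y | 0 < lam α y} ⊆ U α

/-- A `Γ`-structure is *smoothly numerable* if it is represented by a cocycle over a countable,
smoothly numerable open cover. -/
def GammaStructure.SmoothlyNumerable [DiffeologicalGroupoid Γ]
    (s : GammaStructure.{u, v, w} Γ X) : Prop :=
  ∃ c : GammaCocycle.{u, v, w} Γ X,
    (Quotient.mk _ c : GammaStructure Γ X) = s ∧ SmoothlyNumerableCover c.U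

theorem dSmooth_prodMk_const (t : unitInterval) : DSmooth fun y : X ↦ (y, t) :=
  fun _ _ hp ↦ ⟨hp, isPlot_const⟩

/-- Two `Γ`-structures on `X` are *smoothly, numerably homotopic* if some smoothly numerable
`Γ`-structure on `X × [0,1]` induces them on `X ≅ X × {0}` and `X ≅ X × {1}`. -/
def GammaStructure.SmoothlyNumerablyHomotopic [DiffeologicalGroupoid Γ]
    (s₀ s₁ : GammaStructure.{u, v, w} Γ X) : Prop :=
  ∃ k : GammaStructure.{u, v, w} Γ (X × unitInterval), k.SmoothlyNumerable ∧
    k.pullback (fun y ↦ (y, 0)) (dSmooth_prodMk_const 0) = s₀ ∧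
    k.pullback (fun y ↦ (y, 1)) (dSmooth_prodMk_const 1) = s₁

/-- Smooth homotopy of maps of diffeological spaces. -/
def SmoothlyHomotopic (f g : X → Y) : Prop :=
  ∃ H : X × unitInterval → Y, DSmooth H ∧ (∀ y, H (y, 0) = f y) ∧ ∀ y, H (y, 1) = g y

end Cocycle

/-! ### The classifying space -/

section Classifying

variable (Γ : Type u) [Groupoid.{v} Γ]

/-- The functor `Fin (n + 1) ⥤ Fin (n + 2)` that skips `i`. -/
def skip {n : ℕ} (i : Fin (n + 2)) : Fin (n + 1) ⥤ Fin (n + 2) :=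
  (Fin.strictMono_succAbove i).monotone.functor

/-- A point of the disjoint union over `n` of `Δₙ × (ℕ⁽ⁿ⁾ × Γ⁽ⁿ⁾)`. A composable `n`-tuple
`(γ₁, …, γₙ)`, where the source of `γᵢ` is the range of `γᵢ₊₁`, is encoded as the contravariant
functor from the ordered set `{0 < ⋯ < n}` to `Γ` which sends `0` to the range of `γ₁`, `i ≥ 1` to
the source of `γᵢ`, and `i - 1 ≤ i` to `γᵢ`; for `n = 0` this is an object of `Γ`. -/
structure BSimplex where
  /-- the dimension `n` -/
  dim : ℕ
  /-- the barycentric coordinates -/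
  t : Fin (dim + 1) → ℝ
  t_mem : t ∈ stdSimplex ℝ (Fin (dim + 1))
  /-- the strictly increasing tuple of natural numbers -/
  a : Fin (dim + 1) → ℕ
  strictMono_a : StrictMono a
  /-- the composable tuple of arrows -/
  chain : (Fin (dim + 1))ᵒᵖ ⥤ Γ

variable {Γ}

theorem insertNth_zero_mem_stdSimplex {n : ℕ} (i : Fin (n + 2)) {t : Fin (n + 1) → ℝ}
    (ht : t ∈ stdSimplex ℝ (Fin (n + 1))) :
    (i.insertNth 0 t : Fin (n + 2) → ℝ) ∈ stdSimplex ℝ (Fin (n + 2)) := by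
  refine ⟨fun k ↦ ?_, ?_⟩
  · induction k using i.succAboveCases with
    | x => simp
    | p k => simpa using ht.1 k
  · rw [Fin.sum_univ_succAbove _ i]
    simpa using ht.2

/-- The relation `(dᵢ t, y) ∼ (t, ∂ᵢ y)` for `t ∈ Δₙ` and `y = (a, chain) ∈ ℕ⁽ⁿ⁺¹⁾ × Γ⁽ⁿ⁺¹⁾`: the
face inclusion `dᵢ` inserts a `0` at position `i`, the face map of `ℕ^•` omits the `i`-th entry, and
that of the nerve omits the `i`-th object and composes the arrows around it. -/
inductive BSimplex.Rel : BSimplex Γ → BSimplex Γ → Prop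
  | face (n : ℕ) (i : Fin (n + 2)) (t : Fin (n + 1) → ℝ) (ht : t ∈ stdSimplex ℝ (Fin (n + 1)))
      (a : Fin (n + 2) → ℕ) (ha : StrictMono a) (chain : (Fin (n + 2))ᵒᵖ ⥤ Γ) :
      BSimplex.Rel
        ⟨n + 1, i.insertNth 0 t, insertNth_zero_mem_stdSimplex i ht, a, ha, chain⟩
        ⟨n, t, ht, a ∘ i.succAbove, ha.comp (Fin.strictMono_succAbove i), (skip i).op ⋙ chain⟩

variable (Γ) in
/-- The underlying set of the classifying space: the fat realisation `‖ℕ^• × Γ^•‖`, the quotient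
by the equivalence relation generated by `BSimplex.Rel`. -/
def ClassifyingSpace : Type (max u v) := Quot (BSimplex.Rel (Γ := Γ))

/-- The class of a point. -/
def ClassifyingSpace.mk (p : BSimplex Γ) : ClassifyingSpace Γ := Quot.mk _ p

theorem ClassifyingSpace.mk_surjective :
    Function.Surjective (ClassifyingSpace.mk : BSimplex Γ → ClassifyingSpace Γ) :=
  Quot.mk_surjective

namespace BSimplex

/-- The coordinate `u_α`. -/
def bary (α : ℕ) (p : BSimplex Γ) : ℝ := ∑ i, if p.a i = α then p.t i else 0

/-- The arrow `gᵢ = γ₁ ⋯ γᵢ` (a unit for `i = 0`). -/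
def leg (p : BSimplex Γ) (i : Fin (p.dim + 1)) :
    p.chain.obj (.op i) ⟶ p.chain.obj (.op 0) :=
  p.chain.map (homOfLE (Fin.zero_le i)).op

/-- The arrow `gᵢ⁻¹ gⱼ`. -/
def arrow (p : BSimplex Γ) (i j : Fin (p.dim + 1)) : Arr Γ :=
  ⟨p.chain.obj (.op j), p.chain.obj (.op i), p.leg j ≫ Groupoid.inv (p.leg i)⟩

theorem bary_apply (p : BSimplex Γ) (i : Fin (p.dim + 1)) : p.bary (p.a i) = p.t i := by
  simp [bary, p.strictMono_a.injective.eq_iff]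

theorem exists_of_bary_pos {α : ℕ} {p : BSimplex Γ} (h : 0 < p.bary α) : ∃ i, p.a i = α := by
  by_contra! hne
  simp [bary, hne] at h

open Classical in
/-- `gᵢ⁻¹ gⱼ`, where `α = αᵢ` and `β = αⱼ` and both coordinates are positive; `none` if there are
no such `i` and `j`. -/
noncomputable def transition (α β : ℕ) (p : BSimplex Γ) : Option (Arr Γ) :=
  if h : ∃ k : Fin (p.dim + 1) × Fin (p.dim + 1),
      p.a k.1 = α ∧ p.a k.2 = β ∧ 0 < p.t k.1 ∧ 0 < p.t k.2
  then some (p.arrow h.choose.1 h.choose.2) else none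

theorem transition_eq_some {p : BSimplex Γ} {i j : Fin (p.dim + 1)} (hi : 0 < p.t i)
    (hj : 0 < p.t j) : p.transition (p.a i) (p.a j) = some (p.arrow i j) := by
  have h : ∃ k : Fin (p.dim + 1) × Fin (p.dim + 1),
      p.a k.1 = p.a i ∧ p.a k.2 = p.a j ∧ 0 < p.t k.1 ∧ 0 < p.t k.2 := ⟨(i, j), rfl, rfl, hi, hj⟩
  rw [transition, dif_pos h, p.strictMono_a.injective h.choose_spec.1,
    p.strictMono_a.injective h.choose_spec.2.1]

theorem transition_eq_none {α β : ℕ} {p : BSimplex Γ} (h : ¬ (0 < p.bary α ∧ 0 < p.bary β)) :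
    p.transition α β = none := by
  rw [transition, dif_neg]
  rintro ⟨⟨i, j⟩, rfl, rfl, hi, hj⟩
  exact h ⟨p.bary_apply i ▸ hi, p.bary_apply j ▸ hj⟩

theorem Rel.bary_eq {p q : BSimplex Γ} (h : Rel p q) (α : ℕ) : p.bary α = q.bary α := by
  obtain ⟨n, i, t, ht, a, ha, F⟩ := h
  simp [bary, Fin.sum_univ_succAbove _ i]

theorem arrow_eq (p : BSimplex Γ) {i j k : Fin (p.dim + 1)} (hi : k ≤ i) (hj : k ≤ j) :
    p.arrow i j = ⟨p.chain.obj (.op j), p.chain.obj (.op i),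
      p.chain.map (homOfLE hj).op ≫ Groupoid.inv (p.chain.map (homOfLE hi).op)⟩ := by
  have e : ∀ {l} (hl : k ≤ l), p.leg l = p.chain.map (homOfLE hl).op ≫ p.leg k := fun hl ↦ by
    rw [leg, leg, ← Functor.map_comp]; rfl
  rw [arrow, e hi, e hj]
  simp

theorem Rel.transition_eq {p q : BSimplex Γ} (h : Rel p q) (α β : ℕ) :
    p.transition α β = q.transition α β := by
  by_cases hpos : 0 < q.bary α ∧ 0 < q.bary β
  · obtain ⟨hα, hβ⟩ := hpos
    obtain ⟨i, rfl⟩ := exists_of_bary_pos hα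
    obtain ⟨j, rfl⟩ := exists_of_bary_pos hβ
    rw [bary_apply] at hα hβ
    rw [transition_eq_some hα hβ]
    obtain ⟨n, l, t, ht, a, ha, F⟩ := h
    refine (transition_eq_some (p := ⟨n + 1, l.insertNth 0 t, insertNth_zero_mem_stdSimplex l ht,
      a, ha, F⟩) (i := l.succAbove i) (j := l.succAbove j) (by simpa using hα)
      (by simpa using hβ)).trans ?_
    congr 1
    exact arrow_eq ⟨n + 1, l.insertNth 0 t, insertNth_zero_mem_stdSimplex l ht, a, ha, F⟩
      (i := l.succAbove i) (j := l.succAbove j) (k := l.succAbove 0)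
      ((Fin.strictMono_succAbove l).monotone (Fin.zero_le i))
      ((Fin.strictMono_succAbove l).monotone (Fin.zero_le j))
  · rw [transition_eq_none hpos, transition_eq_none]
    rwa [h.bary_eq, h.bary_eq]

theorem arrow_isComp (p : BSimplex Γ) (i j k : Fin (p.dim + 1)) :
    (p.arrow i j).IsComp (p.arrow j k) (p.arrow i k) :=
  ⟨rfl, by simp [arrow, Arr.comp]⟩

end BSimplex

namespace ClassifyingSpace

/-- The coordinate map `u_α : BΓ → [0,1]`. -/
def bary (α : ℕ) : ClassifyingSpace Γ → ℝ :=
  Quot.lift (BSimplex.bary α) fun _ _ h ↦ h.bary_eq α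

variable (Γ) in
/-- The sets `U_α = {u_α > 0}` of the canonical cover. -/
def U (α : ℕ) : Set (ClassifyingSpace Γ) := {b | 0 < bary α b}

/-- The map `gᵢ⁻¹ gⱼ` on the quotient, with value `none` outside of `U_α ∩ U_β`. -/
noncomputable def transition (α β : ℕ) : ClassifyingSpace Γ → Option (Arr Γ) :=
  Quot.lift (BSimplex.transition α β) fun _ _ h ↦ h.transition_eq α β

theorem transition_isSome {α β : ℕ} (b : ↥(U Γ α ∩ U Γ β)) : (transition α β b.1).isSome := by
  obtain ⟨b, hα, hβ⟩ := b
  obtain ⟨p, rfl⟩ := mk_surjective b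
  have hα' : 0 < p.bary α := hα
  have hβ' : 0 < p.bary β := hβ
  obtain ⟨i, rfl⟩ := BSimplex.exists_of_bary_pos hα'
  obtain ⟨j, rfl⟩ := BSimplex.exists_of_bary_pos hβ'
  rw [BSimplex.bary_apply] at hα' hβ'
  change (p.transition _ _).isSome
  rw [BSimplex.transition_eq_some hα' hβ']
  rfl

/-- The canonical cocycle `γ_{αβ} : U_α ∩ U_β → Γ⁽¹⁾`. -/
noncomputable def cocycle (α β : ℕ) (b : ↥(U Γ α ∩ U Γ β)) : Arr Γ :=
  (transition α β b.1).get (transition_isSome b)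

/-- The defining formula of the canonical cocycle, valid for all representatives. -/
theorem cocycle_mk (p : BSimplex Γ) (i j : Fin (p.dim + 1))
    (h : mk p ∈ U Γ (p.a i) ∩ U Γ (p.a j)) :
    cocycle (p.a i) (p.a j) ⟨mk p, h⟩ = p.arrow i j := by
  have hi : 0 < p.bary (p.a i) := h.1
  have hj : 0 < p.bary (p.a j) := h.2
  rw [BSimplex.bary_apply] at hi hj
  exact Option.get_of_eq_some _ (BSimplex.transition_eq_some hi hj)

theorem cocycle_isComp (α β δ : ℕ) (b : ClassifyingSpace Γ) (hα : b ∈ U Γ α) (hβ : b ∈ U Γ β)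
    (hδ : b ∈ U Γ δ) :
    (cocycle α β ⟨b, hα, hβ⟩).IsComp (cocycle β δ ⟨b, hβ, hδ⟩) (cocycle α δ ⟨b, hα, hδ⟩) := by
  obtain ⟨p, rfl⟩ := mk_surjective b
  obtain ⟨i, rfl⟩ := BSimplex.exists_of_bary_pos (p := p) hα
  obtain ⟨j, rfl⟩ := BSimplex.exists_of_bary_pos (p := p) hβ
  obtain ⟨k, rfl⟩ := BSimplex.exists_of_bary_pos (p := p) hδ
  convert! p.arrow_isComp i j k using 1 <;> exact cocycle_mk p _ _ _

theorem exists_mem_U (b : ClassifyingSpace Γ) : ∃ α, b ∈ U Γ α := by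
  obtain ⟨p, rfl⟩ := mk_surjective b
  by_contra! h
  have h0 : ∀ i, p.t i ≤ 0 := fun i ↦ by
    have : ¬ 0 < p.bary (p.a i) := h (p.a i)
    rwa [BSimplex.bary_apply, not_lt] at this
  have := p.t_mem.2
  linarith [Finset.sum_nonpos fun i (_ : i ∈ Finset.univ) ↦ h0 i]

theorem isOpen_preimage_U {n : ℕ} {p : EuclideanSpace ℝ (Fin n) → ClassifyingSpace Γ}
    (hp : ∀ α, IsPlot fun y ↦ bary α (p y)) (α β : ℕ) : IsOpen (p ⁻¹' (U Γ α ∩ U Γ β)) :=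
  have h : ∀ α, IsOpen (p ⁻¹' U Γ α) := fun α ↦
    isOpen_lt continuous_const (hp α).contDiff.continuous
  (h α).inter (h β)

variable [DiffeologicalSpace (Arr Γ)]

/-- The Mostow diffeology on `BΓ`: a map `p` is a plot iff all `u_α ∘ p` are smooth and all
`γ_{αβ} ∘ p` are plots on the open sets `p ⁻¹' (U_α ∩ U_β)`. By `mostow_isGreatest` below it is the
largest diffeology for which the `u_α` are smooth and the `γ_{αβ}` are locally smooth. -/
instance mostow : DiffeologicalSpace (ClassifyingSpace Γ) where
  plots n := {p | (∀ α, IsPlot fun y ↦ bary α (p y)) ∧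
    ∀ α β, IsOpen (p ⁻¹' (U Γ α ∩ U Γ β)) ∧
      DSmooth fun y : ↥(p ⁻¹' (U Γ α ∩ U Γ β)) ↦ cocycle α β ⟨p y, y.2⟩}
  constant_plots b := by
    refine ⟨fun α ↦ isPlot_const, fun α β ↦ ⟨isOpen_const, fun m q hq ↦ ?_⟩⟩
    exact isPlot_const (x := cocycle α β ⟨b, (q 0).2⟩)
  plot_reparam {n m p f} hp hf := by
    refine ⟨fun α ↦ isPlot_reparam (hp.1 α) hf, fun α β ↦
      ⟨(hp.2 α β).1.preimage hf.continuous, fun k q hq ↦ ?_⟩⟩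
    refine (hp.2 α β).2 k (fun y ↦ ⟨f (q y), (q y).2⟩) ?_
    exact isPlot_subtype_iff.2 (hf.comp (isPlot_subtype_iff.1 hq).contDiff).isPlot
  locality {n p} hp := by
    have h1 : ∀ α, IsPlot fun y ↦ bary α (p y) := fun α ↦
      DiffeologicalSpace.locality fun y ↦ by
        obtain ⟨s, hs, hy, h⟩ := hp y
        exact ⟨s, hs, hy, fun hf hf' ↦ (h hf hf').1 α⟩
    refine ⟨h1, fun α β ↦ ⟨isOpen_preimage_U h1 α β, fun m q hq ↦ ?_⟩⟩
    have hq' : ContDiff ℝ ∞ fun y ↦ (q y).1 := (isPlot_subtype_iff.1 hq).contDiff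
    refine DiffeologicalSpace.locality fun y ↦ ?_
    obtain ⟨s, hs, hy, h⟩ := hp (q y)
    refine ⟨_, hs.preimage hq'.continuous, hy, fun {k f} hf hf' ↦ ?_⟩
    exact ((h (f := fun z ↦ (q (f z)).1) hf (hq'.comp hf')).2 α β).2 k
      (fun z ↦ ⟨z, (q (f z)).2⟩) (isPlot_subtype_iff.2 isPlot_id)

theorem mostow_isGreatest :
    IsGreatest {d : DiffeologicalSpace (ClassifyingSpace Γ) |
      (∀ α, @DSmooth _ _ d _ (bary (Γ := Γ) α)) ∧
      ∀ α β, @LocallySmooth _ _ d _ (U Γ α ∩ U Γ β) (cocycle α β)} mostow := by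
  refine ⟨⟨fun α n p hp ↦ hp.1 α, fun α β n p hp ↦ hp.2 α β⟩, fun d hd ↦ ?_⟩
  rw [DiffeologicalSpace.le_iff']
  exact fun n p hp ↦ ⟨fun α ↦ hd.1 α n p hp, fun α β ↦ hd.2 α β n p hp⟩

theorem isOpen_U (α : ℕ) : IsOpen[dTopology] (U Γ α) :=
  isOpen_iff_preimages_plots.2 fun n p hp ↦ by
    simpa using (hp.2 α α).1

theorem isCocycle : IsCocycle (U Γ) (cocycle (Γ := Γ)) where
  smooth α β n p hp := by
    have h := ((hp : IsPlot (fun y ↦ (p y).1)).2 α β).2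
    exact h n (fun y ↦ ⟨y, (p y).2⟩) (isPlot_subtype_iff.2 isPlot_id)
  comp := cocycle_isComp

variable (Γ) in
/-- The canonical cocycle over the canonical cover `(U_α)` of `BΓ`; the index set `ℕ` is lifted to
the universe of the index sets. -/
noncomputable def canonicalCocycle : GammaCocycle.{u, v, w} Γ (ClassifyingSpace Γ) where
  ι := ULift.{w} ℕ
  U α := U Γ α.down
  isOpen_U α := isOpen_U α.down
  cover := Set.eq_univ_of_forall fun b ↦ by
    obtain ⟨α, hα⟩ := exists_mem_U b
    exact Set.mem_iUnion.2 ⟨⟨α⟩, hα⟩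
  h α β := cocycle α.down β.down
  isCocycle := isCocycle.reindex dSmooth_id ULift.down fun _ _ hb ↦ hb

variable (Γ) in
/-- The canonical `Γ`-structure on `BΓ`. -/
noncomputable def canonicalStructure [DiffeologicalGroupoid Γ] :
    GammaStructure.{u, v, w} Γ (ClassifyingSpace Γ) :=
  Quotient.mk _ (canonicalCocycle Γ)

end ClassifyingSpace

end Classifying

/-!
A point of `BΓ` is the same thing as a finitely supported family of weights `r n ≥ 0` with sum `1`,
together with arrows of `Γ`, one for each pair of indices of positive weight, that satisfy the
cocycle relation: such data come from a point (`ClassifyingSpace.exists_bary_transition`), and they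
determine it, because every class has a representative in the interior of its simplex
(`ClassifyingSpace.ext`). Since the Mostow diffeology tests exactly the coordinates and the
transition arrows, a smooth map `X → BΓ` amounts to a point-finite smooth partition of unity `r n`
on `X` and a `Γ`-cocycle on the sets `{r n > 0}` (`ClassifyingSpace.exists_dSmooth_map`). No local
finiteness is needed, and this makes infinite processes harmless as long as each single coordinate
varies smoothly.

*Numerability.* A point-finite smooth partition of unity `r n` is made locally finite by cutting off
`r n` where it is at most `2⁻ⁿ⁻²` and where its predecessors already have sum at least `3 / 4`. Both
cut-offs involve finite sums only, hence are smooth, and at each point some function survives since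
`∑ 2⁻ⁿ⁻² < 3 / 4` (`smoothlyNumerableCover_of_pointFinite`).

*Universality.* The partition of unity and the arrows of a cocycle over a numerable cover, indexed
by natural numbers, define the classifying map
(`ClassifyingSpace.exists_eq_pullback_of_smoothlyNumerable`).

*Homotopy.* A smooth homotopy of maps pulls the canonical structure back to a numerable homotopy of
structures. Conversely, a numerable homotopy of structures is classified by a smooth homotopy, so
that it remains to see that maps `f` and `g` inducing the same structure are homotopic
(`ClassifyingSpace.smoothlyHomotopic_of_pullback_eq`). If the coordinates of `f` live on the even
and those of `g` on the odd vertices, then the cocycle over the union of the two covers allows the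
convex combination of the coordinates (`ClassifyingSpace.smoothlyHomotopic_of_isCocycle`). That `f`
can be moved to the even vertices, and `g` to the odd ones, is seen by transferring the weights one
after the other, in infinitely many steps during `[0,1]`
(`ClassifyingSpace.exists_smoothlyHomotopic_relabel`).
-/

/-! ### Arrows and functors from cocycles -/

namespace Arr

variable {Γ : Type u} [Groupoid.{v} Γ]

theorem IsComp.tgt_eq {g k l : Arr Γ} (h : g.IsComp k l) : l.tgt = g.tgt := by
  obtain ⟨_, rfl⟩ := h; rfl

theorem isComp_mk_iff {a b c : Γ} {g : b ⟶ a} {k : c ⟶ b} {l : c ⟶ a} :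
    (⟨b, a, g⟩ : Arr Γ).IsComp ⟨c, b, k⟩ ⟨c, a, l⟩ ↔ k ≫ g = l := by
  simp [IsComp, comp]

/-- A factor of a composite is determined by the composite and the other factor. -/
theorem IsComp.left_cancel {g k k' l : Arr Γ} (h : g.IsComp k l) (h' : g.IsComp k' l) :
    k = k' := by
  obtain ⟨a, b, g⟩ := g
  obtain ⟨c, d, k⟩ := k
  obtain ⟨c', d', k'⟩ := k'
  obtain ⟨e, f, l⟩ := l
  obtain rfl : e = c := h.src_eq
  obtain rfl : e = c' := h'.src_eq
  obtain rfl : f = b := h.tgt_eq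
  obtain rfl : a = d := h.1
  obtain rfl : a = d' := h'.1
  rw [isComp_mk_iff] at h h'
  rw [(cancel_mono g).1 (h.trans h'.symm)]

end Arr

/-- A family of arrows indexed by the pairs of elements of a preorder and satisfying the cocycle
relation comes from a contravariant functor. -/
theorem exists_functor_of_isComp {Γ : Type u} [Groupoid.{v} Γ] {P : Type w} [Preorder P]
    (τ : P → P → Arr Γ) (hτ : ∀ i j k, (τ i j).IsComp (τ j k) (τ i k)) :
    ∃ F : Pᵒᵖ ⥤ Γ, ∀ i j (h : i ≤ j),
      (⟨F.obj (.op j), F.obj (.op i), F.map (homOfLE h).op⟩ : Arr Γ) = τ i j := by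
  have key : ∀ i j, ∃ m : (τ j j).src ⟶ (τ i i).src, (⟨_, _, m⟩ : Arr Γ) = τ i j := fun i j ↦ by
    have h1 : (τ j j).src = (τ i j).src := (hτ i j j).src_eq.symm
    have h2 : (τ i i).src = (τ i j).tgt := (hτ i i j).1
    rw [h1, h2]
    exact ⟨(τ i j).hom, rfl⟩
  choose m hm using key
  have hcomp : ∀ i j k, m j k ≫ m i j = m i k := fun i j k ↦ by
    have h := hτ i j k
    rwa [← hm i j, ← hm j k, ← hm i k, Arr.isComp_mk_iff] at h
  exact ⟨{  obj := fun i ↦ (τ i.unop i.unop).src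
            map := fun {i j} _ ↦ m j.unop i.unop
            map_id := fun i ↦ by
              rw [← cancel_mono (m i.unop i.unop), hcomp, Category.id_comp]
            map_comp := fun f g ↦ (hcomp _ _ _).symm }, fun i j _ ↦ hm i j⟩

/-! ### Points of the classifying space -/

section Points

variable {Γ : Type u} [Groupoid.{v} Γ]

namespace BSimplex

theorem arrow_of_le (p : BSimplex Γ) {i j : Fin (p.dim + 1)} (h : i ≤ j) :
    p.arrow i j = ⟨p.chain.obj (.op j), p.chain.obj (.op i), p.chain.map (homOfLE h).op⟩ := by
  rw [p.arrow_eq le_rfl h]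
  simp

/-- Every point of the fat realisation has a representative in the interior of its simplex. -/
theorem exists_mk_eq_forall_pos (p : BSimplex Γ) :
    ∃ q : BSimplex Γ, ClassifyingSpace.mk q = ClassifyingSpace.mk p ∧ ∀ i, 0 < q.t i := by
  obtain ⟨n, t, ht, a, ha, F⟩ := p
  induction n with
  | zero =>
    refine ⟨_, rfl, fun i ↦ ?_⟩
    have h := ht.2
    rw [Fin.sum_univ_one] at h
    obtain rfl : i = (0 : Fin 1) := Fin.fin_one_eq_zero i
    change 0 < t 0
    rw [h]
    exact one_pos
  | succ n ih =>
    by_cases hpos : ∀ i, 0 < t i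
    · exact ⟨_, rfl, hpos⟩
    push Not at hpos
    obtain ⟨i, hi⟩ := hpos
    have hi0 : t i = 0 := le_antisymm hi (ht.1 i)
    have hins : t = i.insertNth 0 (fun k ↦ t (i.succAbove k)) := by
      funext k
      induction k using i.succAboveCases with
      | x => simpa using hi0
      | p k => simp
    have ht' : (fun k ↦ t (i.succAbove k)) ∈ stdSimplex ℝ (Fin (n + 1)) := by
      refine ⟨fun k ↦ ht.1 _, ?_⟩
      have := ht.2
      rwa [Fin.sum_univ_succAbove _ i, hi0, zero_add] at this
    obtain ⟨q, hq, hpos⟩ := ih _ ht' _ (ha.comp (Fin.strictMono_succAbove i)) ((skip i).op ⋙ F)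
    refine ⟨q, hq.trans ?_, hpos⟩
    refine (Quot.sound (Rel.face n i _ ht' a ha F)).symm.trans ?_
    congr 2
    exact hins.symm

theorem mem_range_a_iff {p : BSimplex Γ} (hp : ∀ i, 0 < p.t i) (α : ℕ) :
    α ∈ Set.range p.a ↔ 0 < p.bary α :=
  ⟨by rintro ⟨i, rfl⟩; rw [bary_apply]; exact hp i, exists_of_bary_pos⟩

/-- Points in the interiors of simplices are determined by their coordinates and transition
arrows. -/
theorem eq_of_bary_of_transition {p q : BSimplex Γ} (hp : ∀ i, 0 < p.t i) (hq : ∀ i, 0 < q.t i)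
    (hb : ∀ α, p.bary α = q.bary α) (ht : ∀ α β, p.transition α β = q.transition α β) :
    p = q := by
  have hr : Set.range p.a = Set.range q.a := by
    ext α
    rw [mem_range_a_iff hp, mem_range_a_iff hq, hb]
  have hdim : p.dim = q.dim := by
    have h := congrArg Set.ncard hr
    rw [← Set.image_univ, ← Set.image_univ, Set.ncard_image_of_injective _ p.strictMono_a.injective,
      Set.ncard_image_of_injective _ q.strictMono_a.injective] at h
    simpa [Set.ncard_univ] using h
  obtain ⟨n, t, htm, a, ha, F⟩ := p
  obtain ⟨m, t', htm', a', ha', G⟩ := q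
  obtain rfl : n = m := hdim
  obtain rfl : a = a' := (StrictMono.range_inj ha ha').1 hr
  obtain rfl : t = t' := by
    funext i
    have := hb (a i)
    rwa [bary_apply ⟨n, t, htm, a, ha, F⟩, bary_apply ⟨n, t', htm', a, ha', G⟩] at this
  have harr : ∀ i j : Fin (n + 1), i ≤ j → ∀ h : i ≤ j,
      (⟨F.obj (.op j), F.obj (.op i), F.map (homOfLE h).op⟩ : Arr Γ) =
      ⟨G.obj (.op j), G.obj (.op i), G.map (homOfLE h).op⟩ := fun i j _ h ↦ by
    have := ht (a i) (a j)
    rw [transition_eq_some (p := ⟨n, t, htm, a, ha, F⟩) (hp i) (hp j),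
      transition_eq_some (p := ⟨n, t, htm', a, ha', G⟩) (hq i) (hq j), Option.some_inj,
      arrow_of_le _ h, arrow_of_le _ h] at this
    exact this
  obtain rfl : F = G := by
    refine Functor.hext (fun i ↦ congrArg Arr.src (harr i.unop i.unop le_rfl le_rfl)) ?_
    intro i j f
    exact (Arr.ext_iff.1 (harr j.unop i.unop (leOfHom f.unop) (leOfHom f.unop))).2.2
  rfl

end BSimplex

namespace ClassifyingSpace

/-- A point of `BΓ` is determined by its coordinates and transition arrows. -/
theorem ext {b c : ClassifyingSpace Γ} (hb : ∀ α, bary α b = bary α c)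
    (ht : ∀ α β, 0 < bary α b → 0 < bary β b → transition α β b = transition α β c) : b = c := by
  obtain ⟨p, rfl⟩ := mk_surjective b
  obtain ⟨q, rfl⟩ := mk_surjective c
  obtain ⟨p', hp', hp⟩ := p.exists_mk_eq_forall_pos
  obtain ⟨q', hq', hq⟩ := q.exists_mk_eq_forall_pos
  rw [← hp', ← hq'] at hb ht ⊢
  refine congrArg mk (BSimplex.eq_of_bary_of_transition hp hq hb fun α β ↦ ?_)
  by_cases h : 0 < p'.bary α ∧ 0 < p'.bary β
  · exact ht α β h.1 h.2
  · rw [BSimplex.transition_eq_none h, BSimplex.transition_eq_none]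
    rwa [show q'.bary α = p'.bary α from (hb α).symm, show q'.bary β = p'.bary β from (hb β).symm]

/-- A finitely supported family of weights with sum `1`, together with a compatible family of
arrows between the members of its support, is the family of coordinates and transition arrows of a
point of `BΓ`. -/
theorem exists_bary_transition (r : ℕ → ℝ) (hr : ∀ n, 0 ≤ r n) (hfin : {n | 0 < r n}.Finite)
    (hsum : ∑ᶠ n, r n = 1) (τ : ∀ n m, 0 < r n → 0 < r m → Arr Γ)
    (hτ : ∀ n m l hn hm hl, (τ n m hn hm).IsComp (τ m l hm hl) (τ n l hn hl)) :
    ∃ b : ClassifyingSpace Γ, (∀ n, bary n b = r n) ∧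
      ∀ n m hn hm, transition n m b = some (τ n m hn hm) := by
  obtain ⟨s, hs⟩ := hfin.exists_finset
  simp only [Set.mem_ofPred_eq] at hs
  have hzero : ∀ n, n ∉ s → r n = 0 := fun n hn ↦
    le_antisymm (not_lt.1 fun h ↦ hn ((hs n).2 h)) (hr n)
  have hsum' : ∑ n ∈ s, r n = 1 := by
    rw [← finsum_eq_sum_of_support_subset r, hsum]
    intro n hn
    by_contra h
    exact hn (hzero n h)
  obtain ⟨d, hd⟩ : ∃ d, s.card = d + 1 := by
    refine Nat.exists_eq_succ_of_ne_zero fun h ↦ ?_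
    rw [Finset.card_eq_zero] at h
    simp [h] at hsum'
  let e := s.orderEmbOfFin hd
  have he : ∀ i, 0 < r (e i) := fun i ↦ (hs _).1 (s.orderEmbOfFin_mem hd i)
  have hrange : ∀ n, 0 < r n → ∃ i, e i = n := fun n hn ↦ by
    have : n ∈ Set.range (s.orderEmbOfFin hd) := by
      rw [Finset.range_orderEmbOfFin]
      exact (hs n).2 hn
    exact this
  obtain ⟨F, hF⟩ := exists_functor_of_isComp (fun i j ↦ τ (e i) (e j) (he i) (he j))
    fun i j k ↦ hτ _ _ _ _ _ _
  have hmem : (fun i ↦ r (e i)) ∈ stdSimplex ℝ (Fin (d + 1)) := by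
    refine ⟨fun i ↦ hr _, ?_⟩
    rw [← hsum', ← Finset.map_orderEmbOfFin_univ s hd, Finset.sum_map]
    rfl
  let p : BSimplex Γ := ⟨d, fun i ↦ r (e i), hmem, e, e.strictMono, F⟩
  have hbary : ∀ n, bary n (mk p) = r n := fun n ↦ by
    by_cases hn : 0 < r n
    · obtain ⟨i, rfl⟩ := hrange n hn
      exact p.bary_apply i
    · have h0 : r n = 0 := le_antisymm (not_lt.1 hn) (hr n)
      rw [h0]
      exact Finset.sum_eq_zero (fun i _ ↦ if_neg fun h : e i = n ↦ hn (h ▸ he i) :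
        ∀ i ∈ Finset.univ, (if p.a i = n then p.t i else 0) = 0)
  refine ⟨mk p, hbary, fun n m hn hm ↦ ?_⟩
  obtain ⟨i, rfl⟩ := hrange n hn
  obtain ⟨j, rfl⟩ := hrange m hm
  refine (BSimplex.transition_eq_some (p := p) (i := i) (j := j) (he i) (he j)).trans ?_
  have h0 : ∀ k, p.arrow 0 k = τ (e 0) (e k) (he 0) (he k) := fun k ↦
    (p.arrow_of_le (Fin.zero_le k)).trans (hF 0 k (Fin.zero_le k))
  have h1 := p.arrow_isComp 0 i j
  rw [h0, h0] at h1
  exact congrArg some (h1.left_cancel (hτ _ _ _ _ _ _))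

theorem transition_eq_some_cocycle {α β : ℕ} (b : ClassifyingSpace Γ)
    (h : b ∈ U Γ α ∩ U Γ β) : transition α β b = some (cocycle α β ⟨b, h⟩) :=
  (Option.some_get _).symm

theorem cocycle_eq_of_transition {α β : ℕ} {b : ClassifyingSpace Γ} {g : Arr Γ}
    (h : b ∈ U Γ α ∩ U Γ β) (hg : transition α β b = some g) : cocycle α β ⟨b, h⟩ = g :=
  Option.some_inj.1 ((transition_eq_some_cocycle b h).symm.trans hg)

theorem bary_nonneg (α : ℕ) (b : ClassifyingSpace Γ) : 0 ≤ bary α b := by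
  obtain ⟨p, rfl⟩ := mk_surjective b
  change 0 ≤ p.bary α
  refine Finset.sum_nonneg fun i _ ↦ ?_
  split_ifs
  exacts [p.t_mem.1 i, le_rfl]

theorem finite_bary_pos (b : ClassifyingSpace Γ) : {α | 0 < bary α b}.Finite := by
  obtain ⟨p, rfl⟩ := mk_surjective b
  exact (Set.finite_range p.a).subset fun α hα ↦ BSimplex.exists_of_bary_pos hα

theorem finsum_bary (b : ClassifyingSpace Γ) : ∑ᶠ α, bary α b = 1 := by
  obtain ⟨p, rfl⟩ := mk_surjective b
  rw [finsum_eq_sum_of_support_subset (s := Finset.univ.map ⟨p.a, p.strictMono_a.injective⟩),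
    Finset.sum_map, ← p.t_mem.2]
  · exact Finset.sum_congr rfl fun i _ ↦ p.bary_apply i
  · intro α hα
    obtain ⟨i, hi⟩ := p.exists_of_bary_pos ((bary_nonneg α (mk p)).lt_of_ne' hα)
    simpa using ⟨i, hi⟩

end ClassifyingSpace

end Points

/-! ### Smooth maps on subspaces and products -/

section Smooth

variable {X : Type*} [DiffeologicalSpace X] {Y : Type*} [DiffeologicalSpace Y]

theorem dSmooth_fst : DSmooth (Prod.fst : X × Y → X) := fun _ _ hp ↦ hp.1

theorem dSmooth_snd : DSmooth (Prod.snd : X × Y → Y) := fun _ _ hp ↦ hp.2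

theorem dSmooth_coe_unitInterval : DSmooth ((↑) : unitInterval → ℝ) := fun _ _ hp ↦ hp

theorem Diffeology.DSmooth.add {f g : X → ℝ} (hf : DSmooth f) (hg : DSmooth g) :
    DSmooth fun y ↦ f y + g y :=
  fun n p hp ↦ ((hf n p hp).contDiff.add (hg n p hp).contDiff).isPlot

theorem Diffeology.DSmooth.sub {f g : X → ℝ} (hf : DSmooth f) (hg : DSmooth g) :
    DSmooth fun y ↦ f y - g y :=
  fun n p hp ↦ ((hf n p hp).contDiff.sub (hg n p hp).contDiff).isPlot

theorem Diffeology.DSmooth.mul {f g : X → ℝ} (hf : DSmooth f) (hg : DSmooth g) :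
    DSmooth fun y ↦ f y * g y :=
  fun n p hp ↦ ((hf n p hp).contDiff.mul (hg n p hp).contDiff).isPlot

theorem Diffeology.DSmooth.div {f g : X → ℝ} (hf : DSmooth f) (hg : DSmooth g) (h : ∀ y, g y ≠ 0) :
    DSmooth fun y ↦ f y / g y :=
  fun n p hp ↦ ((hf n p hp).contDiff.div (hg n p hp).contDiff fun _ ↦ h _).isPlot

theorem Diffeology.DSmooth.finsetSum {ι : Type*} (s : Finset ι) {f : ι → X → ℝ}
    (hf : ∀ i, DSmooth (f i)) : DSmooth fun y ↦ ∑ i ∈ s, f i y :=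
  fun n p hp ↦ (ContDiff.sum fun i _ ↦ (hf i n p hp).contDiff : ContDiff ℝ ∞ _).isPlot

theorem ContDiff.comp_dSmooth {φ : ℝ → ℝ} (hφ : ContDiff ℝ ∞ φ) {f : X → ℝ} (hf : DSmooth f) :
    DSmooth fun y ↦ φ (f y) :=
  hφ.dSmooth.comp hf

/-- Smoothness is local for the D-topology: a map that agrees near each point with some smooth map
is smooth. -/
theorem dSmooth_of_locally_eq {f : X → Y}
    (h : ∀ y, ∃ O, IsOpen[dTopology] O ∧ y ∈ O ∧ ∃ g : X → Y, DSmooth g ∧ ∀ z ∈ O, f z = g z) :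
    DSmooth f := by
  intro n p hp
  refine DiffeologicalSpace.locality fun a ↦ ?_
  obtain ⟨O, hO, haO, g, hg, hfg⟩ := h (p a)
  refine ⟨p ⁻¹' O, isOpen_iff_preimages_plots.1 hO n p hp, haO, fun {m φ} hφ hφs ↦ ?_⟩
  convert! hg m _ (isPlot_reparam hp hφs) using 1
  funext b
  exact hfg _ (hφ b)

theorem isOpen_preimage_of_dSmooth {f : X → ℝ} (hf : DSmooth f) {s : Set ℝ} (hs : IsOpen s) :
    IsOpen[dTopology] (f ⁻¹' s) :=
  isOpen_iff_preimages_plots.2 fun n p hp ↦ hs.preimage (hf n p hp).contDiff.continuous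

theorem isClosed_preimage_of_dSmooth {f : X → ℝ} (hf : DSmooth f) {s : Set ℝ} (hs : IsClosed s) :
    IsClosed[dTopology] (f ⁻¹' s) :=
  @IsClosed.mk _ dTopology _ (isOpen_preimage_of_dSmooth hf hs.isOpen_compl)

end Smooth

/-! ### Reindexing cocycles -/

theorem cochain_congr {X ι A : Type*} {U : ι → Set X} (h : ∀ α β, ↥(U α ∩ U β) → A)
    {α α' β β' : ι} (hα : α = α') (hβ : β = β') {y : X} (hy : y ∈ U α ∩ U β)
    (hy' : y ∈ U α' ∩ U β') : h α β ⟨y, hy⟩ = h α' β' ⟨y, hy'⟩ := by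
  subst hα hβ
  rfl

section Cocycle

variable {Γ : Type u} [Groupoid.{v} Γ] [DiffeologicalSpace (Arr Γ)]
  {X : Type x} [DiffeologicalSpace X] {Y : Type*} [DiffeologicalSpace Y]

/-- Pulling back a cocycle along a smooth map, where the index assigned to a member of the new
cover may vary over it, but only in a locally constant way. -/
theorem IsCocycle.reindex_locallyConst {ι κ : Type*} {U : ι → Set X}
    {h : ∀ α β, ↥(U α ∩ U β) → Arr Γ} (hh : IsCocycle U h) {V : κ → Set Y} {φ : Y → X}
    (hφ : DSmooth φ) (σ : κ → Y → ι) (hσ : ∀ k, ∀ y ∈ V k, φ y ∈ U (σ k y))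
    (hloc : ∀ k, ∀ y ∈ V k, ∃ O, IsOpen[dTopology] O ∧ y ∈ O ∧ ∀ z ∈ O ∩ V k, σ k z = σ k y) :
    IsCocycle V fun k l (y : ↥(V k ∩ V l)) ↦
      h (σ k y) (σ l y) ⟨φ y, hσ k y y.2.1, hσ l y y.2.2⟩ where
  smooth k l n p hp := by
    have hp' : IsPlot fun a ↦ (p a : Y) := hp
    refine DiffeologicalSpace.locality fun a ↦ ?_
    obtain ⟨O, hO, haO, hO'⟩ := hloc k _ (p a).2.1
    obtain ⟨Q, hQ, haQ, hQ'⟩ := hloc l _ (p a).2.2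
    refine ⟨(fun b ↦ (p b : Y)) ⁻¹' O ∩ (fun b ↦ (p b : Y)) ⁻¹' Q,
      (isOpen_iff_preimages_plots.1 hO n _ hp').inter (isOpen_iff_preimages_plots.1 hQ n _ hp'),
      ⟨haO, haQ⟩, fun {m f} hf hfs ↦ ?_⟩
    have e1 : ∀ b, σ k (p (f b)) = σ k (p a) := fun b ↦ hO' _ ⟨(hf b).1, (p (f b)).2.1⟩
    have e2 : ∀ b, σ l (p (f b)) = σ l (p a) := fun b ↦ hQ' _ ⟨(hf b).2, (p (f b)).2.2⟩
    have hmem : ∀ b, φ (p (f b)) ∈ U (σ k (p a)) ∩ U (σ l (p a)) := fun b ↦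
      ⟨e1 b ▸ hσ k _ (p (f b)).2.1, e2 b ▸ hσ l _ (p (f b)).2.2⟩
    convert! hh.smooth (σ k (p a)) (σ l (p a)) m (fun b ↦ ⟨φ (p (f b)), hmem b⟩)
      (hφ m _ (isPlot_reparam (X := Y) hp' hfs)) using 1
    funext b
    exact cochain_congr h (e1 b) (e2 b) _ _
  comp k l m y hk hl hm := hh.comp _ _ _ _ (hσ k y hk) (hσ l y hl) (hσ m y hm)

/-- A cocycle is equivalent to its restrictions to refinements of its cover. -/
theorem GammaCocycle.equivalent_of_refinement {c d : GammaCocycle.{u, v, w} Γ X} (f : d.ι → c.ι)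
    (hf : ∀ k, d.U k ⊆ c.U (f k))
    (hd : ∀ k l y, d.h k l y = c.h (f k) (f l) ⟨y, hf k y.2.1, hf l y.2.2⟩) : c.Equivalent d :=
  ⟨_, c.isCocycle.reindex dSmooth_id (Sum.elim id f) (by
      rintro (k | k) y hy
      exacts [hy, hf k hy]),
    fun _ _ _ ↦ rfl, fun k l y ↦ (hd k l y).symm⟩

end Cocycle

/-! ### Smooth homotopy -/

section Homotopy

variable {X : Type*} [DiffeologicalSpace X] {Y : Type*} [DiffeologicalSpace Y]

/-- Reparametrising the time of a cylinder by a smooth function is smooth. -/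
theorem dSmooth_prodMk_unitInterval {φ : ℝ → ℝ} (hφ : ContDiff ℝ ∞ φ)
    (h : ∀ t, φ t ∈ unitInterval) :
    DSmooth fun z : X × unitInterval ↦ (z.1, (⟨φ z.2, h z.2⟩ : unitInterval)) :=
  fun n _ hp ↦ ⟨hp.1, hφ.dSmooth n _ hp.2⟩

theorem SmoothlyHomotopic.symm {f g : X → Y} (h : SmoothlyHomotopic f g) :
    SmoothlyHomotopic g f := by
  obtain ⟨H, hH, h0, h1⟩ := h
  refine ⟨fun z ↦ H (z.1, unitInterval.symm z.2), hH.comp fun n p hp ↦ ⟨hp.1, ?_⟩,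
    fun y ↦ by simpa using h1 y, fun y ↦ by simpa using h0 y⟩
  have h2 : IsPlot fun a ↦ ((p a).2 : ℝ) := hp.2
  exact (contDiff_const.sub h2.contDiff : ContDiff ℝ ∞ fun a ↦ (1 : ℝ) - (p a).2).isPlot

theorem smoothTransition_mem_unitInterval (t : ℝ) : Real.smoothTransition t ∈ unitInterval :=
  ⟨Real.smoothTransition.nonneg t, Real.smoothTransition.le_one t⟩

/-- Two smooth homotopies can be concatenated after reparametrising them so that they are
stationary near the time at which they are joined. -/
theorem SmoothlyHomotopic.trans {f g k : X → Y} (h : SmoothlyHomotopic f g)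
    (h' : SmoothlyHomotopic g k) : SmoothlyHomotopic f k := by
  obtain ⟨H, hH, h0, h1⟩ := h
  obtain ⟨K, hK, k0, k1⟩ := h'
  let ρ : ℝ → unitInterval := fun t ↦
    ⟨Real.smoothTransition (3 * t), smoothTransition_mem_unitInterval _⟩
  let ρ' : ℝ → unitInterval := fun t ↦
    ⟨Real.smoothTransition (3 * t - 2), smoothTransition_mem_unitInterval _⟩
  have hρ : ∀ t, 1 / 3 ≤ t → ρ t = 1 := fun t ht ↦
    Subtype.ext (Real.smoothTransition.one_of_one_le (by linarith))
  have hρ' : ∀ t, t ≤ 2 / 3 → ρ' t = 0 := fun t ht ↦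
    Subtype.ext (Real.smoothTransition.zero_of_nonpos (by linarith))
  have hsm : DSmooth fun z : X × unitInterval ↦ H (z.1, ρ z.2) :=
    hH.comp (dSmooth_prodMk_unitInterval (φ := fun t ↦ Real.smoothTransition (3 * t))
      (Real.smoothTransition.contDiff.comp (contDiff_const.mul contDiff_id))
      fun _ ↦ smoothTransition_mem_unitInterval _)
  have hsm' : DSmooth fun z : X × unitInterval ↦ K (z.1, ρ' z.2) :=
    hK.comp (dSmooth_prodMk_unitInterval (φ := fun t ↦ Real.smoothTransition (3 * t - 2))
      (Real.smoothTransition.contDiff.comp ((contDiff_const.mul contDiff_id).sub contDiff_const))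
      fun _ ↦ smoothTransition_mem_unitInterval _)
  have ht : DSmooth fun z : X × unitInterval ↦ (z.2 : ℝ) :=
    dSmooth_coe_unitInterval.comp dSmooth_snd
  refine ⟨fun z ↦ if (z.2 : ℝ) ≤ 1 / 2 then H (z.1, ρ z.2) else K (z.1, ρ' z.2),
    dSmooth_of_locally_eq fun z ↦ ?_, fun y ↦ ?_, fun y ↦ ?_⟩
  · rcases lt_or_ge (z.2 : ℝ) (2 / 3) with hz | hz
    · refine ⟨_, isOpen_preimage_of_dSmooth ht isOpen_Iio, hz, _, hsm, fun a ha ↦ ?_⟩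
      have ha' : (a.2 : ℝ) < 2 / 3 := ha
      split_ifs with hh
      · rfl
      · rw [hρ _ (by linarith), hρ' _ ha'.le, h1, k0]
    · refine ⟨_, isOpen_preimage_of_dSmooth ht isOpen_Ioi,
        show (1 / 3 : ℝ) < z.2 by linarith, _, hsm', fun a ha ↦ ?_⟩
      have ha' : (1 / 3 : ℝ) < a.2 := ha
      split_ifs with hh
      · rw [hρ _ ha'.le, hρ' _ (by linarith), h1, k0]
      · rfl
  · have : ρ 0 = 0 := Subtype.ext (Real.smoothTransition.zero_of_nonpos (by norm_num))
    simp [this, h0]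
  · have : ρ' 1 = 1 := Subtype.ext (Real.smoothTransition.one_of_one_le (by norm_num))
    have h2 : ¬ ((1 : unitInterval) : ℝ) ≤ 1 / 2 := by norm_num
    refine (if_neg h2).trans ?_
    simp [this, k1]

end Homotopy

/-! ### Smooth maps to the classifying space -/

section MapsToClassifying

variable {Γ : Type u} [Groupoid.{v} Γ] [DiffeologicalSpace (Arr Γ)]
  {X : Type x} [DiffeologicalSpace X]

namespace ClassifyingSpace

theorem dSmooth_bary (α : ℕ) : DSmooth (bary (Γ := Γ) α) := fun _ _ hp ↦ hp.1 α

/-- Smooth weights on `X`, together with a cocycle on the sets where they are positive, are the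
coordinates and the transition arrows of a smooth map to the classifying space. The weights have to
be pointwise finite only: the Mostow diffeology tests the coordinates one by one. -/
theorem exists_dSmooth_map (r : ℕ → X → ℝ) (hr : ∀ n, DSmooth (r n)) (h0 : ∀ n y, 0 ≤ r n y)
    (hfin : ∀ y, {n | 0 < r n y}.Finite) (hsum : ∀ y, ∑ᶠ n, r n y = 1)
    {τ : ∀ n m, ↥({y | 0 < r n y} ∩ {y | 0 < r m y}) → Arr Γ}
    (hτ : IsCocycle (fun n ↦ {y | 0 < r n y}) τ) :
    ∃ η : X → ClassifyingSpace Γ, DSmooth η ∧ (∀ n y, bary n (η y) = r n y) ∧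
      ∀ n m y hn hm, transition n m (η y) = some (τ n m ⟨y, hn, hm⟩) := by
  have key : ∀ y, ∃ b : ClassifyingSpace Γ, (∀ n, bary n b = r n y) ∧
      ∀ n m hn hm, transition n m b = some (τ n m ⟨y, hn, hm⟩) := fun y ↦
    exists_bary_transition (fun n ↦ r n y) (fun n ↦ h0 n y) (hfin y) (hsum y)
      (fun n m hn hm ↦ τ n m ⟨y, hn, hm⟩) fun n m l hn hm hl ↦ hτ.comp n m l y hn hm hl
  choose η hη hητ using key
  refine ⟨η, fun n p hp ↦ ?_, fun n y ↦ hη y n, fun n m y hn hm ↦ hητ y n m hn hm⟩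
  have h1 : ∀ α, IsPlot fun a ↦ bary α (η (p a)) := fun α ↦ by
    simp only [hη]
    exact hr α n p hp
  refine ⟨h1, fun α β ↦ ⟨isOpen_preimage_U h1 α β, fun m q hq ↦ ?_⟩⟩
  have hmem : ∀ a, p (q a) ∈ {y | 0 < r α y} ∩ {y | 0 < r β y} := fun a ↦
    ⟨(q a).2.1.trans_eq (hη (p (q a)) α), (q a).2.2.trans_eq (hη (p (q a)) β)⟩
  convert! hτ.smooth α β m (fun a ↦ ⟨p (q a), hmem a⟩)
    (isPlot_reparam (X := X) hp (isPlot_subtype_iff.1 hq).contDiff) using 1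
  funext a
  exact cocycle_eq_of_transition _ (hητ _ _ _ (hmem a).1 (hmem a).2)

end ClassifyingSpace

end MapsToClassifying

/-! ### Numerability of point-finite partitions of unity -/

section Numerable

variable {X : Type*} [DiffeologicalSpace X]

theorem SmoothlyNumerableCover.comp_equiv {ι κ : Type*} {U : ι → Set X}
    (h : SmoothlyNumerableCover U) (e : κ ≃ ι) : SmoothlyNumerableCover fun k ↦ U (e k) := by
  obtain ⟨hc, lam, h1, h2, h3, h4, h5⟩ := h
  refine ⟨e.injective.countable, fun k ↦ lam (e k), fun k ↦ h1 _, fun k ↦ h2 _, ?_, fun y ↦ ?_,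
    fun k ↦ h5 _⟩
  · let _ : TopologicalSpace X := dTopology
    have := LocallyFinite.comp_injective h3 e.injective
    exact this
  · rw [← h4 y]
    exact finsum_comp_equiv e (f := fun α ↦ lam α y)

theorem exists_sum_range_eq_one {X : Type*} {r : ℕ → X → ℝ}
    (h0 : ∀ n y, 0 ≤ r n y) (hfin : ∀ y, {n | 0 < r n y}.Finite)
    (hsum : ∀ y, ∑ᶠ n, r n y = 1) (y : X) : ∃ N, ∑ i ∈ Finset.range N, r i y = 1 := by
  obtain ⟨N, hN⟩ := (hfin y).bddAbove
  refine ⟨N + 1, ?_⟩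
  rw [← hsum y]
  refine (finsum_eq_sum_of_support_subset _ fun n hn ↦ ?_).symm
  have : n ≤ N := hN ((h0 n y).lt_of_ne' hn)
  simpa [Nat.lt_succ_iff] using this

/-- If all partial sums below `3 / 4` were followed by a term `r n ≤ 2⁻ⁿ⁻²`, all partial sums would
be below `1 / 2`. -/
theorem exists_lt_and_sum_range_lt {a : ℕ → ℝ} {N : ℕ} (hN : ∑ i ∈ Finset.range N, a i = 1) :
    ∃ n, (1 / 2 : ℝ) ^ (n + 2) < a n ∧ ∑ i ∈ Finset.range n, a i < 3 / 4 := by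
  by_contra! hcon
  have key : ∀ n, ∑ i ∈ Finset.range n, a i ≤ 1 / 2 - (1 / 2 : ℝ) ^ (n + 1) := fun n ↦ by
    induction n with
    | zero => simp
    | succ n ih =>
      have hpos : (0 : ℝ) < (1 / 2) ^ (n + 1) := by positivity
      have h1 : a n ≤ (1 / 2 : ℝ) ^ (n + 2) := by
        by_contra! h
        linarith [hcon n h]
      rw [Finset.sum_range_succ]
      rw [show n + 2 = n + 1 + 1 from rfl, pow_succ _ (n + 1)] at h1
      rw [pow_succ _ (n + 1)]
      linarith
  have hpos : (0 : ℝ) < (1 / 2) ^ (N + 1) := by positivity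
  linarith [key N]

/-- The sets on which the members of a point-finite smooth partition of unity are positive form a
smoothly numerable cover. Local finiteness is achieved by cutting off the `n`-th function where it
is at most `2⁻ⁿ⁻²` and where the sum of its predecessors is at least `3 / 4`. -/
theorem smoothlyNumerableCover_of_pointFinite {r : ℕ → X → ℝ}
    (hr : ∀ n, DSmooth (r n)) (h0 : ∀ n y, 0 ≤ r n y)
    (hfin : ∀ y, {n | 0 < r n y}.Finite) (hsum : ∀ y, ∑ᶠ n, r n y = 1) :
    SmoothlyNumerableCover fun n ↦ {y | 0 < r n y} := by
  let P : ℕ → X → ℝ := fun n y ↦ ∑ i ∈ Finset.range n, r i y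
  have hP : ∀ n, DSmooth (P n) := fun n ↦ DSmooth.finsetSum _ hr
  have hPmono : ∀ y, Monotone fun n ↦ P n y := fun y ↦
    monotone_nat_of_le_succ fun n ↦ by
      simp only [P, Finset.sum_range_succ]
      linarith [h0 n y]
  have hP1 : ∀ y, ∃ N, P N y = 1 := exists_sum_range_eq_one h0 hfin hsum
  let v : ℕ → X → ℝ := fun n y ↦
    expNegInvGlue (r n y - (1 / 2) ^ (n + 2)) * expNegInvGlue (3 / 4 - P n y)
  have hv : ∀ n, DSmooth (v n) := fun n ↦
    (expNegInvGlue.contDiff.comp_dSmooth ((hr n).sub dSmooth_const)).mul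
      (expNegInvGlue.contDiff.comp_dSmooth (dSmooth_const.sub (hP n)))
  have hv0 : ∀ n y, 0 ≤ v n y := fun n y ↦
    mul_nonneg (expNegInvGlue.nonneg _) (expNegInvGlue.nonneg _)
  have hvpos : ∀ y, ∃ n, 0 < v n y := fun y ↦ by
    obtain ⟨N, hN⟩ := hP1 y
    obtain ⟨n, hn, hn'⟩ := exists_lt_and_sum_range_lt hN
    exact ⟨n, mul_pos (expNegInvGlue.pos_of_pos (sub_pos.2 hn))
      (expNegInvGlue.pos_of_pos (sub_pos.2 hn'))⟩
  have hvle : ∀ n y, 0 < v n y → (1 / 2) ^ (n + 2) ≤ r n y := fun n y h ↦ by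
    by_contra! hlt
    simp only [v, expNegInvGlue.zero_of_nonpos (sub_nonpos.2 hlt.le), zero_mul, lt_irrefl] at h
  -- On the open set where the `N`-th partial sum exceeds `3 / 4`, all `v n` with `n ≥ N` vanish.
  have hvz : ∀ N n y, 3 / 4 < P N y → N ≤ n → v n y = 0 := fun N n y h hn ↦ by
    have : 3 / 4 < P n y := h.trans_le (hPmono y hn)
    simp [v, expNegInvGlue.zero_of_nonpos (sub_nonpos.2 this.le)]
  have hO : ∀ N, IsOpen[dTopology] {y | 3 / 4 < P N y} := fun N ↦
    isOpen_preimage_of_dSmooth (hP N) isOpen_Ioi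
  have hvfin : ∀ y, (Function.support fun n ↦ v n y).Finite := fun y ↦ by
    obtain ⟨N, hN⟩ := hP1 y
    refine (Set.finite_lt_nat N).subset fun n hn ↦ ?_
    by_contra! h
    exact hn (hvz N n y (by rw [hN]; norm_num) (not_lt.1 h))
  let S : X → ℝ := fun y ↦ ∑ᶠ n, v n y
  have hS : DSmooth S := dSmooth_of_locally_eq fun y ↦ by
    obtain ⟨N, hN⟩ := hP1 y
    refine ⟨_, hO N, show 3 / 4 < P N y by rw [hN]; norm_num, _,
      DSmooth.finsetSum (Finset.range N) hv, fun z hz ↦ ?_⟩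
    refine finsum_eq_sum_of_support_subset _ fun n hn ↦ ?_
    by_contra h
    exact hn (hvz N n z hz (by simpa using h))
  have hle : ∀ n y, v n y ≤ S y := fun n y ↦ single_le_finsum n (hvfin y) fun m ↦ hv0 m y
  have hSpos : ∀ y, 0 < S y := fun y ↦ by
    obtain ⟨n, hn⟩ := hvpos y
    exact hn.trans_le (hle n y)
  have hpos : ∀ n y, 0 < v n y / S y → 0 < v n y := fun n y h ↦ by
    rwa [div_pos_iff_of_pos_right (hSpos y)] at h
  refine ⟨inferInstance, fun n y ↦ v n y / S y, fun n ↦ (hv n).div hS fun y ↦ (hSpos y).ne',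
    fun n y ↦ ⟨div_nonneg (hv0 n y) (hSpos y).le, (div_le_one (hSpos y)).2 (hle n y)⟩, ?_,
    fun y ↦ ?_, fun n ↦ ?_⟩
  · let _ : TopologicalSpace X := dTopology
    refine LocallyFinite.closure fun y ↦ ?_
    obtain ⟨N, hN⟩ := hP1 y
    refine ⟨_, (hO N).mem_nhds (show 3 / 4 < P N y by rw [hN]; norm_num),
      (Set.finite_lt_nat N).subset ?_⟩
    rintro n ⟨z, hz, hzN⟩
    by_contra! h
    exact (hpos n z hz).ne' (hvz N n z hzN (not_lt.1 h))
  · simp only [div_eq_mul_inv]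
    rw [← finsum_mul' _ _ (hvfin y)]
    exact mul_inv_cancel₀ (hSpos y).ne'
  · let _ : TopologicalSpace X := dTopology
    have hcl : IsClosed {y | (1 / 2 : ℝ) ^ (n + 2) ≤ r n y} :=
      isClosed_preimage_of_dSmooth (hr n) isClosed_Ici
    refine (closure_minimal (fun y hy ↦ hvle n y (hpos n y hy)) hcl).trans fun y hy ↦ ?_
    have hy' : (1 / 2 : ℝ) ^ (n + 2) ≤ r n y := hy
    exact lt_of_lt_of_le (by positivity) hy'

end Numerable

/-! ### The canonical structure is numerable and universal -/

section Universal

variable {Γ : Type u} [Groupoid.{v} Γ] [DiffeologicalSpace (Arr Γ)]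
  {X : Type x} [DiffeologicalSpace X]

namespace ClassifyingSpace

theorem smoothlyNumerableCover_bary {f : X → ClassifyingSpace Γ} (hf : DSmooth f) :
    SmoothlyNumerableCover fun n : ULift.{w} ℕ ↦ f ⁻¹' U Γ n.down :=
  (smoothlyNumerableCover_of_pointFinite (r := fun n y ↦ bary n (f y))
    (fun n ↦ (dSmooth_bary n).comp hf) (fun n y ↦ bary_nonneg n (f y))
    (fun y ↦ finite_bary_pos (f y)) fun y ↦ finsum_bary (f y)).comp_equiv Equiv.ulift

variable [DiffeologicalGroupoid Γ]

theorem smoothlyNumerable_canonicalStructure :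
    (canonicalStructure.{u, v, w} Γ).SmoothlyNumerable :=
  ⟨canonicalCocycle Γ, rfl, smoothlyNumerableCover_bary dSmooth_id⟩

theorem smoothlyNumerable_pullback {f : X → ClassifyingSpace Γ} (hf : DSmooth f) :
    ((canonicalStructure.{u, v, w} Γ).pullback f hf).SmoothlyNumerable :=
  ⟨(canonicalCocycle Γ).pullback f hf, rfl, smoothlyNumerableCover_bary hf⟩

end ClassifyingSpace

theorem finsum_extend_zero {ι κ M : Type*} [AddCommMonoid M] {e : ι → κ}
    (he : Function.Injective e) (a : ι → M) :
    ∑ᶠ k, Function.extend e a 0 k = ∑ᶠ i, a i := by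
  calc ∑ᶠ k, Function.extend e a 0 k = ∑ᶠ k ∈ Set.range e, Function.extend e a 0 k := by
        refine finsum_congr fun k ↦ ?_
        by_cases hk : k ∈ Set.range e
        · simp only [hk, finsum_true]
        · rw [Function.extend_apply' _ _ _ hk]
          simp
    _ = ∑ᶠ i, Function.extend e a 0 (e i) := finsum_mem_range he
    _ = ∑ᶠ i, a i := by simp only [he.extend_apply]

namespace ClassifyingSpace

/-- The smooth map given by the partition of unity and the arrows of a cocycle over a smoothly
numerable cover classifies the structure of that cocycle. -/
theorem exists_eq_pullback_of_smoothlyNumerable [DiffeologicalGroupoid Γ]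
    (h : GammaStructure.{u, v, w} Γ X) (hh : h.SmoothlyNumerable) :
    ∃ (η : X → ClassifyingSpace Γ) (hη : DSmooth η),
      h = (canonicalStructure.{u, v, w} Γ).pullback η hη := by
  obtain ⟨c, rfl, hc, lam, h1, h2, h3, h4, h5⟩ := hh
  obtain ⟨e, he⟩ := exists_injective_nat c.ι
  have hpos : ∀ i, {y | 0 < lam i y} ⊆ c.U i := fun i ↦
    (@subset_closure X dTopology _).trans (h5 i)
  have hfin : ∀ y, {i | 0 < lam i y}.Finite := fun y ↦
    (@LocallyFinite.point_finite _ _ dTopology _ h3 y).subset fun i hi ↦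
      @subset_closure X dTopology {y | 0 < lam i y} y hi
  cases isEmpty_or_nonempty X with
  | inl hX =>
    refine ⟨isEmptyElim, fun n p _ ↦ isEmptyElim (p 0), ?_⟩
    refine Quotient.sound ⟨fun α β y ↦ isEmptyElim (y : X), ⟨fun α β n p _ ↦ ?_, fun α β δ y ↦ ?_⟩,
      fun α β y ↦ isEmptyElim (y : X), fun α β y ↦ isEmptyElim (y : X)⟩
    exacts [isEmptyElim (p 0 : X), isEmptyElim y]
  | inr hX =>
  have : Nonempty c.ι := by
    obtain ⟨y⟩ := hX
    have := c.cover.symm ▸ Set.mem_univ y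
    obtain ⟨i, -⟩ := Set.mem_iUnion.1 this
    exact ⟨i⟩
  let r : ℕ → X → ℝ := fun n y ↦ Function.extend e (fun i ↦ lam i y) 0 n
  have hr : ∀ i y, r (e i) y = lam i y := fun i y ↦ he.extend_apply _ _ _
  have hr0 : ∀ n, n ∉ Set.range e → ∀ y, r n y = 0 := fun n hn y ↦
    Function.extend_apply' _ _ _ hn
  have hrange : ∀ n y, 0 < r n y → ∃ i, e i = n := fun n y hy ↦ by
    by_contra hn
    exact hy.ne' (hr0 n hn y)
  have hsub : ∀ n, ∀ y ∈ {y | 0 < r n y}, y ∈ c.U (Function.invFun e n) := fun n y hy ↦ by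
    obtain ⟨i, rfl⟩ := hrange n y hy
    rw [Function.leftInverse_invFun he i]
    exact hpos i ((show 0 < r (e i) y from hy).trans_eq (hr i y))
  obtain ⟨η, hη, hb, ht⟩ := exists_dSmooth_map r
    (fun n ↦ by
      by_cases hn : n ∈ Set.range e
      · obtain ⟨i, rfl⟩ := hn
        simpa only [funext (hr i)] using h1 i
      · simpa only [funext (hr0 n hn)] using dSmooth_const)
    (fun n y ↦ by
      by_cases hn : n ∈ Set.range e
      · obtain ⟨i, rfl⟩ := hn
        exact (h2 i y).1.trans_eq (hr i y).symm
      · exact (hr0 n hn y).ge)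
    (fun y ↦ ((hfin y).image e).subset fun n hn ↦ by
      obtain ⟨i, rfl⟩ := hrange n y hn
      exact ⟨i, (show 0 < r (e i) y from hn).trans_eq (hr i y), rfl⟩)
    (fun y ↦ (finsum_extend_zero he _).trans (h4 y))
    (c.isCocycle.reindex dSmooth_id (Function.invFun e) hsub)
  refine ⟨η, hη, Quotient.sound ?_⟩
  refine GammaCocycle.equivalent_of_refinement (fun n ↦ Function.invFun e n.down)
    (fun n y hy ↦ hsub n.down y ((show 0 < bary n.down (η y) from hy).trans_eq (hb _ _)))
    fun n m y ↦ ?_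
  exact cocycle_eq_of_transition _ (ht n.down m.down y
    ((show 0 < bary n.down (η y) from y.2.1).trans_eq (hb _ _))
    ((show 0 < bary m.down (η y) from y.2.2).trans_eq (hb _ _)))

end ClassifyingSpace

end Universal

/-! ### Homotopies of maps to the classifying space -/

section Homotopy

/-- Smooth step functions `φ n`, rising from `0` to `1` during successive time intervals of `[0,1]`:
the step of `φ m` is completed at time `b m`, when those of the `φ n` with `n > m` have not yet
begun. -/
theorem exists_successive_smooth_steps : ∃ (φ : ℕ → ℝ → ℝ) (b : ℕ → ℝ),
    (∀ n, ContDiff ℝ ∞ (φ n)) ∧ (∀ n t, φ n t ∈ unitInterval) ∧ (∀ n, φ n 0 = 0) ∧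
    (∀ n, 0 < b n) ∧ (∀ n, b n < 1) ∧ (∀ n t, b n ≤ t → φ n t = 1) ∧
    ∀ m n, m < n → ∀ t, t ≤ b m → φ n t = 0 := by
  -- `φ n` is an affine reparametrisation of the standard step to `[n/(n+1), (n+1)/(n+2)]`.
  refine ⟨fun n t ↦ Real.smoothTransition ((n + 1) * (n + 2) * t - n * (n + 2)),
    fun n ↦ (n + 1) / (n + 2), fun n ↦ ?_, fun n t ↦ smoothTransition_mem_unitInterval _,
    fun n ↦ ?_, fun n ↦ by positivity, fun n ↦ ?_, fun n t ht ↦ ?_, fun m n hmn t ht ↦ ?_⟩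
  · exact Real.smoothTransition.contDiff.comp
      ((contDiff_const.mul contDiff_id).sub contDiff_const)
  · refine Real.smoothTransition.zero_of_nonpos ?_
    have : (0 : ℝ) ≤ n * (n + 2) := by positivity
    linarith
  · rw [div_lt_one (by positivity)]
    linarith
  · refine Real.smoothTransition.one_of_one_le ?_
    rw [div_le_iff₀ (by positivity)] at ht
    nlinarith [(Nat.cast_nonneg n : (0 : ℝ) ≤ n)]
  · refine Real.smoothTransition.zero_of_nonpos ?_
    have hmn' : (m : ℝ) + 1 ≤ n := by exact_mod_cast hmn
    have h1 : ((m : ℝ) + 1) / (m + 2) ≤ n / (n + 1) := by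
      rw [div_le_div_iff₀ (by positivity) (by positivity)]
      nlinarith
    have h2 := ht.trans h1
    rw [le_div_iff₀ (by positivity)] at h2
    nlinarith [(Nat.cast_nonneg n : (0 : ℝ) ≤ n)]

variable {Γ : Type u} [Groupoid.{v} Γ] [DiffeologicalSpace (Arr Γ)]
  {X : Type x} [DiffeologicalSpace X]

namespace ClassifyingSpace

/-- The pullback of the canonical cocycle, with open sets described by the coordinates. -/
theorem isCocycle_comp {f : X → ClassifyingSpace Γ} (hf : DSmooth f) :
    IsCocycle (fun n ↦ {y | 0 < bary n (f y)})
      fun n m (y : ↥({y | 0 < bary n (f y)} ∩ {y | 0 < bary m (f y)})) ↦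
        cocycle (Γ := Γ) n m ⟨f y, y.2⟩ :=
  isCocycle.reindex hf id fun _ _ hy ↦ hy

/-- Along an injective, inflationary relabelling `e` of the vertices, a map `f` can be deformed
so that the vertex `e m` takes over the role of the vertex `m`. Run backwards in time, the vertices
are moved one after the other: during the `m`-th of infinitely many successive steps, the weight of
`m` is transferred from the label `e m` to the label `m`, which has been vacated in an earlier step
or was never in use. The deformation is smooth because each coordinate takes part in at most two
steps. -/
theorem exists_smoothlyHomotopic_relabel {f : X → ClassifyingSpace Γ} (hf : DSmooth f)
    {e : ℕ → ℕ} (he : Function.Injective e) (hle : ∀ m, m ≤ e m) :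
    ∃ g : X → ClassifyingSpace Γ, DSmooth g ∧ SmoothlyHomotopic f g ∧
      (∀ m y, bary (e m) (g y) = bary m (f y)) ∧
      (∀ n ∉ Set.range e, ∀ y, bary n (g y) = 0) ∧
      ∀ m l y, 0 < bary m (f y) → 0 < bary l (f y) →
        transition (e m) (e l) (g y) = transition m l (f y) := by
  obtain ⟨φ, b, hφ, hφI, hφ0, hb0, hb1, hφb, hφb'⟩ := exists_successive_smooth_steps
  let r : ℕ → X × unitInterval → ℝ := fun n z ↦
    Function.extend e (fun m ↦ (1 - φ m z.2) * bary m (f z.1)) 0 n + φ n z.2 * bary n (f z.1)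
  have hre : ∀ m z, r (e m) z =
      (1 - φ m z.2) * bary m (f z.1) + φ (e m) z.2 * bary (e m) (f z.1) := fun m z ↦ by
    simp only [r, he.extend_apply]
  have hrn : ∀ n, n ∉ Set.range e → ∀ z, r n z = φ n z.2 * bary n (f z.1) := fun n hn z ↦ by
    simp [r, Function.extend_apply' _ _ _ hn]
  have hφs : ∀ n, DSmooth fun z : X × unitInterval ↦ φ n z.2 := fun n ↦
    (hφ n).comp_dSmooth (dSmooth_coe_unitInterval.comp dSmooth_snd)
  have hfs : ∀ n, DSmooth fun z : X × unitInterval ↦ bary n (f z.1) := fun n ↦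
    (dSmooth_bary n).comp (hf.comp dSmooth_fst)
  have hr : ∀ n, DSmooth (r n) := fun n ↦ by
    by_cases hn : n ∈ Set.range e
    · obtain ⟨m, rfl⟩ := hn
      rw [funext (hre m)]
      exact ((dSmooth_const.sub (hφs m)).mul (hfs m)).add ((hφs _).mul (hfs _))
    · rw [funext (hrn n hn)]
      exact (hφs n).mul (hfs n)
  have h0 : ∀ n z, 0 ≤ r n z := fun n z ↦ by
    have h2 : 0 ≤ φ n z.2 * bary n (f z.1) := mul_nonneg (hφI n _).1 (bary_nonneg _ _)
    by_cases hn : n ∈ Set.range e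
    · obtain ⟨m, rfl⟩ := hn
      rw [hre]
      exact add_nonneg (mul_nonneg (sub_nonneg.2 (hφI m _).2) (bary_nonneg _ _)) h2
    · rwa [hrn n hn]
  have hsupp : ∀ (a : ℕ → ℝ) y, (Function.support fun n ↦ a n * bary n (f y)).Finite :=
    fun a y ↦ (finite_bary_pos (f y)).subset fun n hn ↦
      (bary_nonneg n (f y)).lt_of_ne' (right_ne_zero_of_mul hn)
  have hsupp' : ∀ z : X × unitInterval, (Function.support
      (Function.extend e (fun m ↦ (1 - φ m z.2) * bary m (f z.1)) 0)).Finite := fun z ↦ by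
    refine ((hsupp (fun m ↦ 1 - φ m z.2) z.1).image e).subset fun n hn ↦ ?_
    by_cases hn' : n ∈ Set.range e
    · obtain ⟨m, rfl⟩ := hn'
      exact ⟨m, by simpa only [Function.mem_support, he.extend_apply] using hn, rfl⟩
    · exact absurd (Function.extend_apply' _ _ _ hn') hn
  have hfin : ∀ z, {n | 0 < r n z}.Finite := fun z ↦ by
    refine ((hsupp' z).union (hsupp (fun n ↦ φ n z.2) z.1)).subset fun n hn ↦ ?_
    by_contra! h
    simp only [Set.mem_union, Function.mem_support, not_or, not_not] at h
    exact (show 0 < r n z from hn).ne' (by simp only [r, h.1, h.2, add_zero])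
  have hsum : ∀ z, ∑ᶠ n, r n z = 1 := fun z ↦ by
    rw [finsum_add_distrib (hsupp' z) (hsupp _ z.1), finsum_extend_zero he,
      ← finsum_add_distrib (hsupp (fun m ↦ 1 - φ m z.2) z.1) (hsupp _ z.1)]
    exact (finsum_congr fun n ↦ by ring).trans (finsum_bary (f z.1))
  -- The vertex whose weight is carried by the label `n` at time `z.2`.
  let σ : ℕ → X × unitInterval → ℕ := fun n z ↦
    open Classical in
    if n ∈ Set.range e ∧ (z.2 : ℝ) < b (Function.invFun e n) then Function.invFun e n else n
  have hσ_lt : ∀ m z, (z.2 : ℝ) < b m → σ (e m) z = m := fun m z hz ↦ by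
    have := Function.leftInverse_invFun he m
    simp [σ, this, hz]
  have hσ_ge : ∀ m z, b m ≤ (z.2 : ℝ) → σ (e m) z = e m := fun m z hz ↦ by
    have := Function.leftInverse_invFun he m
    simp [σ, this, hz.not_gt]
  have hσ_notMem : ∀ n, n ∉ Set.range e → ∀ z, σ n z = n := fun n hn z ↦
    if_neg fun h ↦ hn h.1
  have hσ_fix : ∀ m, m = e m → ∀ z, σ (e m) z = m := fun m hm z ↦ by
    rcases lt_or_ge (z.2 : ℝ) (b m) with hz | hz
    · exact hσ_lt m z hz
    · exact (hσ_ge m z hz).trans hm.symm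
  have hpos_left : ∀ {a c : ℝ}, 0 ≤ c → 0 < a * c → 0 < c := fun hc h ↦
    hc.lt_of_ne' (right_ne_zero_of_mul h.ne')
  have ht : DSmooth fun z : X × unitInterval ↦ (z.2 : ℝ) :=
    dSmooth_coe_unitInterval.comp dSmooth_snd
  have hτ := (isCocycle_comp hf).reindex_locallyConst (V := fun n ↦ {z | 0 < r n z})
    (φ := Prod.fst) dSmooth_fst σ
    (fun n z hz ↦ by
      replace hz : 0 < r n z := hz
      change 0 < bary (σ n z) (f z.1)
      by_cases hn : n ∈ Set.range e
      · obtain ⟨m, rfl⟩ := hn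
        rw [hre] at hz
        rcases (hle m).eq_or_lt with hm | hm
        · rw [hσ_fix m hm]
          rw [← hm, ← add_mul] at hz
          exact hpos_left (bary_nonneg _ _) hz
        · rcases lt_or_ge (z.2 : ℝ) (b m) with hzb | hzb
          · rw [hφb' m _ hm _ hzb.le, zero_mul, add_zero] at hz
            rw [hσ_lt m z hzb]
            exact hpos_left (bary_nonneg _ _) hz
          · rw [hφb m _ hzb, sub_self, zero_mul, zero_add] at hz
            rw [hσ_ge m z hzb]
            exact hpos_left (bary_nonneg _ _) hz
      · rw [hrn n hn] at hz
        rw [hσ_notMem n hn]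
        exact hpos_left (bary_nonneg _ _) hz)
    (fun n z hz ↦ by
      replace hz : 0 < r n z := hz
      by_cases hn : n ∈ Set.range e
      · obtain ⟨m, rfl⟩ := hn
        rcases (hle m).eq_or_lt with hm | hm
        · exact ⟨Set.univ, @isOpen_univ _ dTopology, trivial, fun a _ ↦ by
            rw [hσ_fix m hm, hσ_fix m hm]⟩
        · rcases lt_or_ge (z.2 : ℝ) (b m) with hzb | hzb
          · exact ⟨_, isOpen_preimage_of_dSmooth ht (isOpen_Iio (a := b m)), hzb, fun a ha ↦ by
              rw [hσ_lt m z hzb, hσ_lt m a ha.1]⟩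
          · -- At time `b m` itself the label `e m` carries no weight.
            have hzb' : b m < z.2 := by
              refine hzb.lt_of_ne fun h ↦ hz.ne' ?_
              rw [hre, hφb m _ h.le, hφb' m _ hm _ h.ge]
              ring
            exact ⟨_, isOpen_preimage_of_dSmooth ht (isOpen_Ioi (a := b m)), hzb', fun a ha ↦ by
              rw [hσ_ge m z hzb, hσ_ge m a (le_of_lt ha.1)]⟩
      · exact ⟨Set.univ, @isOpen_univ _ dTopology, trivial, fun a _ ↦ by
          rw [hσ_notMem n hn, hσ_notMem n hn]⟩)
  obtain ⟨H, hH, hHb, hHt⟩ := exists_dSmooth_map r hr h0 hfin hsum hτ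
  have hg : ∀ m y, bary (e m) (H (y, 0)) = bary m (f y) := fun m y ↦ by
    simp [hHb, hre, hφ0]
  have hf1 : ∀ n y, bary n (H (y, 1)) = bary n (f y) := fun n y ↦ by
    rw [hHb]
    by_cases hn : n ∈ Set.range e
    · obtain ⟨m, rfl⟩ := hn
      simp [hre, hφb _ _ (hb1 _).le]
    · simp [hrn n hn, hφb _ _ (hb1 _).le]
  refine ⟨fun y ↦ H (y, 0), hH.comp (dSmooth_prodMk_const 0),
    SmoothlyHomotopic.symm ⟨H, hH, fun _ ↦ rfl, fun y ↦ ext (fun n ↦ hf1 n y) fun n m hn hm ↦ ?_⟩,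
    hg, fun n hn y ↦ ?_, fun m l y hm hl ↦ ?_⟩
  · have hσ1 : ∀ n, σ n (y, 1) = n := fun n ↦ if_neg fun h ↦ (hb1 _).not_gt h.2
    rw [hHt n m _ (hn.trans_eq (hHb n _)) (hm.trans_eq (hHb m _)),
      transition_eq_some_cocycle (f y) ⟨hn.trans_eq (hf1 n y), hm.trans_eq (hf1 m y)⟩]
    exact congrArg some (cochain_congr cocycle (hσ1 n) (hσ1 m) _ _)
  · simp [hHb, hrn n hn, hφ0]
  · have hσ0 : ∀ k, σ (e k) (y, 0) = k := fun k ↦ hσ_lt k _ (hb0 k)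
    rw [hHt (e m) (e l) _ (hm.trans_eq ((hg m y).symm.trans (hHb _ _)))
      (hl.trans_eq ((hg l y).symm.trans (hHb _ _))), transition_eq_some_cocycle (f y) ⟨hm, hl⟩]
    exact congrArg some (cochain_congr cocycle (hσ0 m) (hσ0 l) _ _)

/-- If the arrows of two maps to `BΓ` are restrictions of a single cocycle, with the same index
set, then the maps are homotopic by convex combination of their coordinates. -/
theorem smoothlyHomotopic_of_isCocycle {f g : X → ClassifyingSpace Γ} (hf : DSmooth f)
    (hg : DSmooth g) {V : ℕ → Set X} {τ : ∀ n m, ↥(V n ∩ V m) → Arr Γ} (hτ : IsCocycle V τ)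
    (hfV : ∀ n y, 0 < bary n (f y) → y ∈ V n) (hgV : ∀ n y, 0 < bary n (g y) → y ∈ V n)
    (hfτ : ∀ n m y hn hm, transition n m (f y) = some (τ n m ⟨y, hfV n y hn, hfV m y hm⟩))
    (hgτ : ∀ n m y hn hm, transition n m (g y) = some (τ n m ⟨y, hgV n y hn, hgV m y hm⟩)) :
    SmoothlyHomotopic f g := by
  let r : ℕ → X × unitInterval → ℝ := fun n z ↦
    (1 - (z.2 : ℝ)) * bary n (f z.1) + z.2 * bary n (g z.1)
  have ht : DSmooth fun z : X × unitInterval ↦ (z.2 : ℝ) :=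
    dSmooth_coe_unitInterval.comp dSmooth_snd
  have hsupp : ∀ {k : X → ClassifyingSpace Γ} (a : ℝ) y,
      (Function.support fun n ↦ a * bary n (k y)).Finite :=
    fun a y ↦ (finite_bary_pos _).subset fun n hn ↦
      (bary_nonneg n _).lt_of_ne' (right_ne_zero_of_mul hn)
  have hV : ∀ n, ∀ z ∈ {z | 0 < r n z}, z.1 ∈ V n := fun n z hz ↦ by
    by_contra h
    have h1 := le_antisymm (not_lt.1 (mt (hfV n z.1) h)) (bary_nonneg n _)
    have h2 := le_antisymm (not_lt.1 (mt (hgV n z.1) h)) (bary_nonneg n _)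
    exact (show 0 < r n z from hz).ne' (by simp [r, h1, h2])
  obtain ⟨H, hH, hHb, hHt⟩ := exists_dSmooth_map r
    (fun n ↦ ((dSmooth_const.sub ht).mul ((dSmooth_bary n).comp (hf.comp dSmooth_fst))).add
      (ht.mul ((dSmooth_bary n).comp (hg.comp dSmooth_fst))))
    (fun n z ↦ add_nonneg (mul_nonneg (sub_nonneg.2 z.2.2.2) (bary_nonneg _ _))
      (mul_nonneg z.2.2.1 (bary_nonneg _ _)))
    (fun z ↦ ((hsupp (k := f) (1 - (z.2 : ℝ)) z.1).union (hsupp (k := g) z.2 z.1)).subset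
      fun n hn ↦ by
        by_contra! h
        simp only [Set.mem_union, Function.mem_support, not_or, not_not] at h
        exact (show 0 < r n z from hn).ne' (by simp only [r, h.1, h.2, add_zero]))
    (fun z ↦ by
      rw [finsum_add_distrib (hsupp (k := f) _ z.1) (hsupp (k := g) _ z.1),
        ← mul_finsum, ← mul_finsum, finsum_bary, finsum_bary]
      ring)
    (hτ.reindex dSmooth_fst id hV)
  have hb0 : ∀ n y, bary n (H (y, 0)) = bary n (f y) := fun n y ↦ by simp [hHb, r]
  have hb1 : ∀ n y, bary n (H (y, 1)) = bary n (g y) := fun n y ↦ by simp [hHb, r]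
  refine ⟨H, hH, fun y ↦ ext (fun n ↦ hb0 n y) fun n m hn hm ↦ ?_,
    fun y ↦ ext (fun n ↦ hb1 n y) fun n m hn hm ↦ ?_⟩
  · exact (hHt n m _ (hn.trans_eq (hHb _ _)) (hm.trans_eq (hHb _ _))).trans
      (hfτ n m y (hb0 n y ▸ hn) (hb0 m y ▸ hm)).symm
  · exact (hHt n m _ (hn.trans_eq (hHb _ _)) (hm.trans_eq (hHb _ _))).trans
      (hgτ n m y (hb1 n y ▸ hn) (hb1 m y ▸ hm)).symm

variable [DiffeologicalGroupoid Γ]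

/-- Maps inducing the same `Γ`-structure are homotopic: moving one of them to the even and the other
one to the odd vertices makes room for the arrows between their cocycles. -/
theorem smoothlyHomotopic_of_pullback_eq {f g : X → ClassifyingSpace Γ} (hf : DSmooth f)
    (hg : DSmooth g) (h : (canonicalStructure.{u, v, w} Γ).pullback f hf =
      (canonicalStructure.{u, v, w} Γ).pullback g hg) : SmoothlyHomotopic f g := by
  obtain ⟨τ, hτ, hτf, hτg⟩ : ((canonicalCocycle.{u, v, w} Γ).pullback f hf).Equivalent
    ((canonicalCocycle.{u, v, w} Γ).pullback g hg) := Quotient.exact h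
  obtain ⟨f', hf', hff', hfb, hf0, hft⟩ := exists_smoothlyHomotopic_relabel hf
    (e := fun k ↦ 2 * k) (fun a b hab ↦ by simpa using hab) (fun m ↦ by omega)
  obtain ⟨g', hg', hgg', hgb, hg0, hgt⟩ := exists_smoothlyHomotopic_relabel hg
    (e := fun k ↦ 2 * k + 1) (fun a b hab ↦ by simpa using hab) (fun m ↦ by omega)
  refine (hff'.trans ?_).trans hgg'.symm
  let s : ℕ → ULift.{w} ℕ ⊕ ULift.{w} ℕ := fun n ↦
    if n % 2 = 0 then .inl ⟨n / 2⟩ else .inr ⟨n / 2⟩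
  have hs0 : ∀ k, s (2 * k) = .inl ⟨k⟩ := fun k ↦ by simp [s]
  have hs1 : ∀ k, s (2 * k + 1) = .inr ⟨k⟩ := fun k ↦ by
    have h1 : (2 * k + 1) % 2 = 1 := by omega
    have h2 : (2 * k + 1) / 2 = k := by omega
    simp [s, h1, h2]
  have hf'r : ∀ n y, 0 < bary n (f' y) → ∃ k, n = 2 * k ∧ 0 < bary k (f y) := fun n y hn ↦ by
    by_cases hr : n ∈ Set.range fun k ↦ 2 * k
    · obtain ⟨k, rfl⟩ := hr
      exact ⟨k, rfl, (hfb k y).symm ▸ hn⟩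
    · exact absurd (hf0 n hr y) hn.ne'
  have hg'r : ∀ n y, 0 < bary n (g' y) → ∃ k, n = 2 * k + 1 ∧ 0 < bary k (g y) := fun n y hn ↦ by
    by_cases hr : n ∈ Set.range fun k ↦ 2 * k + 1
    · obtain ⟨k, rfl⟩ := hr
      exact ⟨k, rfl, (hgb k y).symm ▸ hn⟩
    · exact absurd (hg0 n hr y) hn.ne'
  refine smoothlyHomotopic_of_isCocycle hf' hg'
    (hτ.reindex (V := fun n ↦ Sum.elim ((canonicalCocycle.{u, v, w} Γ).pullback f hf).U
      ((canonicalCocycle.{u, v, w} Γ).pullback g hg).U (s n)) dSmooth_id s fun n y hy ↦ hy)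
    (fun n y hn ↦ ?_) (fun n y hn ↦ ?_) (fun n m y hn hm ↦ ?_) (fun n m y hn hm ↦ ?_)
  · obtain ⟨k, rfl, hk⟩ := hf'r n y hn
    rw [hs0]
    exact hk
  · obtain ⟨k, rfl, hk⟩ := hg'r n y hn
    rw [hs1]
    exact hk
  · obtain ⟨k, rfl, hk⟩ := hf'r n y hn
    obtain ⟨l, rfl, hl⟩ := hf'r m y hm
    refine (hft k l y hk hl).trans ((transition_eq_some_cocycle (f y) ⟨hk, hl⟩).trans ?_)
    refine congrArg some ((hτf ⟨k⟩ ⟨l⟩ ⟨y, hk, hl⟩).symm.trans ?_)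
    exact cochain_congr τ (hs0 k).symm (hs0 l).symm _ _
  · obtain ⟨k, rfl, hk⟩ := hg'r n y hn
    obtain ⟨l, rfl, hl⟩ := hg'r m y hm
    refine (hgt k l y hk hl).trans ((transition_eq_some_cocycle (g y) ⟨hk, hl⟩).trans ?_)
    refine congrArg some ((hτg ⟨k⟩ ⟨l⟩ ⟨y, hk, hl⟩).symm.trans ?_)
    exact cochain_congr τ (hs1 k).symm (hs1 l).symm _ _

end ClassifyingSpace

variable [DiffeologicalGroupoid Γ]

theorem GammaStructure.pullback_pullback {Y Z : Type*} [DiffeologicalSpace Y]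
    [DiffeologicalSpace Z] (s : GammaStructure.{u, v, w} Γ X) {φ : Y → X} (hφ : DSmooth φ)
    {ψ : Z → Y} (hψ : DSmooth ψ) :
    (s.pullback φ hφ).pullback ψ hψ = s.pullback (φ ∘ ψ) (hφ.comp hψ) := by
  induction s using Quotient.inductionOn
  rfl

theorem GammaStructure.pullback_congr {Y : Type*} [DiffeologicalSpace Y]
    (s : GammaStructure.{u, v, w} Γ X) {φ ψ : Y → X} (hφ : DSmooth φ) (hψ : DSmooth ψ)
    (h : ∀ y, φ y = ψ y) : s.pullback φ hφ = s.pullback ψ hψ := by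
  obtain rfl : φ = ψ := funext h
  rfl

namespace ClassifyingSpace

theorem smoothlyNumerablyHomotopic_pullback_iff {f g : X → ClassifyingSpace Γ} (hf : DSmooth f)
    (hg : DSmooth g) :
    ((canonicalStructure.{u, v, w} Γ).pullback f hf).SmoothlyNumerablyHomotopic
        ((canonicalStructure.{u, v, w} Γ).pullback g hg) ↔ SmoothlyHomotopic f g := by
  constructor
  · rintro ⟨k, hk, h0, h1⟩
    obtain ⟨η, hη, rfl⟩ := exists_eq_pullback_of_smoothlyNumerable k hk
    rw [GammaStructure.pullback_pullback] at h0 h1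
    exact ((smoothlyHomotopic_of_pullback_eq hf _ h0.symm).trans
      ⟨η, hη, fun _ ↦ rfl, fun _ ↦ rfl⟩).trans (smoothlyHomotopic_of_pullback_eq _ hg h1)
  · rintro ⟨H, hH, h0, h1⟩
    refine ⟨_, smoothlyNumerable_pullback hH, ?_, ?_⟩
    · rw [GammaStructure.pullback_pullback]
      exact GammaStructure.pullback_congr _ _ _ h0
    · rw [GammaStructure.pullback_pullback]
      exact GammaStructure.pullback_congr _ _ _ h1

end ClassifyingSpace

end Homotopy

theorem mainTheorem3 (Γ : Type u) [Groupoid.{v} Γ] [DiffeologicalSpace (Arr Γ)]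
    [DiffeologicalGroupoid Γ] :
    (ClassifyingSpace.canonicalStructure.{u, v, w} Γ).SmoothlyNumerable ∧
    (∀ (X : Type x) [DiffeologicalSpace X] (h : GammaStructure.{u, v, w} Γ X),
      h.SmoothlyNumerable →
        ∃ (η : X → ClassifyingSpace Γ) (hη : DSmooth η),
          h = (ClassifyingSpace.canonicalStructure Γ).pullback η hη) ∧
    (∀ (X : Type x) [DiffeologicalSpace X] (η₀ η₁ : X → ClassifyingSpace Γ)
      (hη₀ : DSmooth η₀) (hη₁ : DSmooth η₁),
      GammaStructure.SmoothlyNumerablyHomotopic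
          ((ClassifyingSpace.canonicalStructure.{u, v, w} Γ).pullback η₀ hη₀)
          ((ClassifyingSpace.canonicalStructure.{u, v, w} Γ).pullback η₁ hη₁) ↔
        SmoothlyHomotopic η₀ η₁) :=
  ⟨ClassifyingSpace.smoothlyNumerable_canonicalStructure,
    fun _ _ h hh ↦ ClassifyingSpace.exists_eq_pullback_of_smoothlyNumerable h hh,
    fun _ _ _ _ h₀ h₁ ↦ ClassifyingSpace.smoothlyNumerablyHomotopic_pullback_iff h₀ h₁⟩
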